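/- **Theorem (Dual Correspondence).** Let $\mathbb K\in\{\mathbb R,\mathbb C\}$, let $V$ be a finite-dimensional $\mathbb K$-vector space, let $U\subseteq\mathbb R^n$ be open and $p\in U$. Let $X\in C^\infty(U,\mathbb R^n)$ have a strictly positive source at $p$, i.e. $X(p)=0$ and all eigenvalues $\mu_1,\dots,\mu_n\in\mathbb C$ of $\mathrm DX|_p$ (complex roots of the characteristic polynomial, repeated with algebraic multiplicity) have positive real part. Assume that $U$ is star-shaped around $p$ with respect to $X$: for every $q\in U$ the integral curve $t\mapsto\Phi_t(q)$ of $X$ exists and stays in $U$ for all $t\le 0$, and $\Phi_t(q)\to p$ as $t\to-\infty$. Let $A\in C^\infty(U,\mathrm{End}_{\mathbb K}(V))$ and let $\nabla=\mathrm D+\Gamma$ be a smooth $\mathbb K$-linear connection on the trivial bundle $U\times V$ (for instance $\nabla=\mathrm D$). Consider $$(\nabla_X+A)u=\mathrm D_Xu+\Gamma(X)u+Au,\qquad u\in C^\infty(U,V),$$ a continuous linear operator on the Fréchet space $C^\infty(U,V)$. Let $\mathcal E'(U,V^*)$ be the topological dual of $C^\infty(U,V)$ (the compactly supported distributions) and let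 $(\nabla_X+A)'T=T\circ(\nabla_X+A)$ be the dual operator on it. For $N\in\mathbb N_0$ let $$\mathfrak m^{N}=\{u\in C^\infty(U,V)\mid \mathrm D^\alpha u(p)=0\ \text{for all}\ |\alpha|<N\},\qquad \mathcal P_N=C^\infty(U,V)/\mathfrak m^{N+1},$$ write $[u]_N$ for the class of $u$ in $\mathcal P_N$, and let $[\nabla_X+A]_N$ be the endomorphism of $\mathcal P_N$ with $[\nabla_X+A]_N[u]_N=[(\nabla_X+A)u]_N$. Let $\lambda\in\mathbb K$ and let $N\in\mathbb N_0$ be such that $|\alpha|\le N$ for every representation $$\lambda=\alpha_1\mu_1+\dots+\alpha_n\mu_n+\rho$$ with a multi-index $\alpha\in\mathbb N_0^n$ and a (complex) eigenvalue $\rho$ of $A(p)$ (no condition on $N$ if $\lambda$ has no such representation). Then every solution $T\in\mathcal E'(U,V^*)$ of $$(\nabla_X+A)'T=\lambda T \tag{1}$$ vanishes on $\mathfrak m^{N+1}$, hence induces $[T]_N\in\mathcal P_N'$ with $[T]_N([u]_N)=T(u)$, and $T\mapsto[T]_N$ is a linear isomorphism from the space of solutions of (1) onto the space of solutions $\boldsymbol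 T\in\mathcal P_N'$ of $$\boldsymbol T\circ[\nabla_X+A]_N=\lambda\boldsymbol T .$$ In particular, every solution $T$ of (1) satisfies $\operatorname{supp}T\subseteq\{p\}$ and has order at most $N$ as a distribution. -/

import Mathlib

open Set Filter Topology TopologicalSpace
open scoped ContDiff

noncomputable section

namespace SourceOperator

/-! ### Eigenvalues, sources, star-shaped neighborhoods -/

/-- The embedding of `𝕜 = ℝ` or `𝕜 = ℂ` into `ℂ`. -/
def toComplex (𝕜 : Type*) [RCLike 𝕜] : 𝕜 →+* ℂ where
  toFun z := ⟨RCLike.re z, RCLike.im z⟩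
  map_one' := by apply Complex.ext <;> simp
  map_zero' := by apply Complex.ext <;> simp
  map_add' x y := by apply Complex.ext <;> simp
  map_mul' x y := by apply Complex.ext <;> simp [RCLike.mul_re, RCLike.mul_im]

/-- The eigenvalues of an endomorphism of a finite-dimensional real or complex vector space: the
complex roots of its characteristic polynomial, counted with algebraic multiplicity. -/
def eigenvalues {𝕜 : Type*} [RCLike 𝕜] {W : Type*} [AddCommGroup W] [Module 𝕜 W]
    [FiniteDimensional 𝕜 W] (f : W →ₗ[𝕜] W) : Multiset ℂ :=
  (f.charpoly.map (toComplex 𝕜)).roots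

variable {E : Type*} [NormedAddCommGroup E] [NormedSpace ℝ E]

/-- The linearization `DX|_p` of a vector field at `p`. -/
def linearization (X : E → E) (p : E) : E →ₗ[ℝ] E := (fderiv ℝ X p).toLinearMap

/-- `p` is a strictly positive source of `X`: `X p = 0` and all eigenvalues of the linearization
have strictly positive real part. -/
structure IsStrictlyPositiveSource [FiniteDimensional ℝ E] (X : E → E) (p : E) : Prop where
  apply_eq_zero : X p = 0
  re_pos : ∀ z ∈ eigenvalues (linearization X p), 0 < z.re

/-- `U` is star-shaped around `p` with respect to `X`: through each `q ∈ U` there is an integral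
curve of `X` that is defined for all `t ≤ 0`, stays in `U` and tends to `p` as `t → -∞`. -/
def IsStarShaped (U : Set E) (X : E → E) (p : E) : Prop :=
  ∀ q ∈ U, ∃ γ : ℝ → E, γ 0 = q ∧ IsIntegralCurveOn γ (fun _ => X) (Iic 0) ∧
    (∀ t ≤ 0, γ t ∈ U) ∧ Tendsto γ atBot (𝓝 p)

/-! ### The Fréchet space `C^∞(U, V)` -/

section Smooth

variable (𝕜 : Type*) [RCLike 𝕜] (U : Opens E)
  (V : Type*) [NormedAddCommGroup V] [NormedSpace ℝ V] [NormedSpace 𝕜 V] [IsScalarTower ℝ 𝕜 V]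

/-- Smooth functions `U → V`, each one represented by its extension by zero to the whole space
(which is a function that need not be continuous at the boundary of `U`). -/
def smoothSubmodule : Submodule 𝕜 (E → V) where
  carrier := {u | ContDiffOn ℝ ∞ u U ∧ ∀ x ∉ U, u x = 0}
  add_mem' {u v} hu hv := ⟨hu.1.add hv.1, fun x hx => by simp [hu.2 x hx, hv.2 x hx]⟩
  zero_mem' := ⟨contDiffOn_const, fun _ _ => rfl⟩
  smul_mem' c u hu := ⟨hu.1.const_smul c, fun x hx => by simp [hu.2 x hx]⟩

/-- The vector space `C^∞(U, V)`. -/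
def SmoothFun : Type _ := ↥(smoothSubmodule 𝕜 U V)

instance : AddCommGroup (SmoothFun 𝕜 U V) := inferInstanceAs (AddCommGroup (smoothSubmodule 𝕜 U V))

instance : Module 𝕜 (SmoothFun 𝕜 U V) := inferInstanceAs (Module 𝕜 (smoothSubmodule 𝕜 U V))

instance : FunLike (SmoothFun 𝕜 U V) E V where
  coe u := u.1
  coe_injective _ _ h := Subtype.ext h

variable {𝕜 U V}

theorem SmoothFun.contDiffOn (u : SmoothFun 𝕜 U V) : ContDiffOn ℝ ∞ u U := u.2.1

theorem SmoothFun.contDiffAt (u : SmoothFun 𝕜 U V) {x : E} (hx : x ∈ U) : ContDiffAt ℝ ∞ u x :=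
  u.contDiffOn.contDiffAt (U.isOpen.mem_nhds hx)

theorem SmoothFun.eq_zero (u : SmoothFun 𝕜 U V) {x : E} (hx : x ∉ U) : u x = 0 := u.2.2 x hx

theorem SmoothFun.coe_add (u v : SmoothFun 𝕜 U V) : ⇑(u + v) = ⇑u + ⇑v := rfl

theorem SmoothFun.coe_smul (c : 𝕜) (u : SmoothFun 𝕜 U V) : ⇑(c • u) = c • ⇑u := rfl

theorem SmoothFun.coe_zero : ⇑(0 : SmoothFun 𝕜 U V) = 0 := rfl

theorem SmoothFun.iteratedFDeriv_add (u v : SmoothFun 𝕜 U V) (k : ℕ) {x : E} (hx : x ∈ U) :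
    iteratedFDeriv ℝ k ⇑(u + v) x = iteratedFDeriv ℝ k u x + iteratedFDeriv ℝ k v x := by
  rw [SmoothFun.coe_add, iteratedFDeriv_add_apply ((u.contDiffAt hx).of_le (by exact_mod_cast le_top))
    ((v.contDiffAt hx).of_le (by exact_mod_cast le_top))]

theorem SmoothFun.iteratedFDeriv_smul (c : 𝕜) (u : SmoothFun 𝕜 U V) (k : ℕ) {x : E} (hx : x ∈ U) :
    iteratedFDeriv ℝ k ⇑(c • u) x = c • iteratedFDeriv ℝ k u x := by
  rw [SmoothFun.coe_smul, iteratedFDeriv_const_smul_apply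
    ((u.contDiffAt hx).of_le (by exact_mod_cast le_top))]

theorem continuousOn_iteratedFDeriv {F : Type*} [NormedAddCommGroup F] [NormedSpace ℝ F]
    {f : E → F} (hf : ContDiffOn ℝ ∞ f U) (k : ℕ) : ContinuousOn (iteratedFDeriv ℝ k f) U :=
  (hf.continuousOn_iteratedFDerivWithin (m := k) (by exact_mod_cast le_top)
    U.isOpen.uniqueDiffOn).congr
    fun _ hx => (iteratedFDerivWithin_of_isOpen k U.isOpen hx).symm

/-- Compact subsets of `U`. -/
abbrev CompactIn (U : Opens E) : Type _ := {K : Compacts E // (K : Set E) ⊆ U}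

theorem exists_bound (K : CompactIn U) {F : Type*} [NormedAddCommGroup F] [NormedSpace ℝ F]
    {f : E → F} (hf : ContDiffOn ℝ ∞ f U) (m : ℕ) :
    ∃ C : ℝ, 0 ≤ C ∧ ∀ x ∈ K.1, ‖iteratedFDeriv ℝ m f x‖ ≤ C := by
  obtain ⟨C, hC⟩ := K.1.isCompact.exists_bound_of_continuousOn
    ((continuousOn_iteratedFDeriv hf m).mono K.2)
  exact ⟨max C 0, le_max_right _ _, fun x hx => (hC x hx).trans (le_max_left _ _)⟩

theorem SmoothFun.bddAbove (u : SmoothFun 𝕜 U V) (K : CompactIn U) (k : ℕ) :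
    BddAbove (range fun x : K.1 => ‖iteratedFDeriv ℝ k u x‖) := by
  have := (K.1.isCompact.image_of_continuousOn
    ((continuousOn_iteratedFDeriv u.contDiffOn k).mono K.2).norm).bddAbove
  rwa [image_eq_range] at this

/-- The seminorm `u ↦ sup_{x ∈ K} ‖D^k u (x)‖` for `K ⊆ U` compact. -/
def derivSeminorm (K : CompactIn U) (k : ℕ) : Seminorm 𝕜 (SmoothFun 𝕜 U V) :=
  Seminorm.of (fun u => ⨆ x : K.1, ‖iteratedFDeriv ℝ k u x‖)
    (fun u v => by
      refine Real.iSup_le (fun x => ?_) (add_nonneg (Real.iSup_nonneg fun _ => norm_nonneg _)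
        (Real.iSup_nonneg fun _ => norm_nonneg _))
      rw [u.iteratedFDeriv_add v k (K.2 x.2)]
      exact (norm_add_le _ _).trans
        (add_le_add (le_ciSup (u.bddAbove K k) x) (le_ciSup (v.bddAbove K k) x)))
    (fun c u => by
      rw [Real.mul_iSup_of_nonneg (norm_nonneg c)]
      congr 1
      funext x
      rw [u.iteratedFDeriv_smul c k (K.2 x.2), norm_smul])

theorem le_derivSeminorm (K : CompactIn U) (k : ℕ) (u : SmoothFun 𝕜 U V) {x : E} (hx : x ∈ K.1) :
    ‖iteratedFDeriv ℝ k u x‖ ≤ derivSeminorm K k u :=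
  le_ciSup (u.bddAbove K k) ⟨x, hx⟩

theorem derivSeminorm_le (K : CompactIn U) (k : ℕ) (u : SmoothFun 𝕜 U V) {C : ℝ} (hC : 0 ≤ C)
    (h : ∀ x ∈ K.1, ‖iteratedFDeriv ℝ k u x‖ ≤ C) : derivSeminorm K k u ≤ C :=
  Real.iSup_le (fun x => h x x.2) hC

variable (𝕜 U V) in
/-- The seminorms that define the Fréchet topology of `C^∞(U, V)`. -/
def seminormFamily : SeminormFamily 𝕜 (SmoothFun 𝕜 U V) (CompactIn U × ℕ) :=
  fun i => derivSeminorm i.1 i.2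

instance : Nonempty (CompactIn U × ℕ) := ⟨⟨⊥, by simp⟩, 0⟩

/-- The Fréchet topology of `C^∞(U, V)`: uniform convergence of all derivatives on compact
subsets of `U`. -/
instance : TopologicalSpace (SmoothFun 𝕜 U V) := (seminormFamily 𝕜 U V).moduleFilterBasis.topology

theorem withSeminorms : WithSeminorms (seminormFamily 𝕜 U V) := ⟨rfl⟩

/-! ### Compactly supported distributions -/

variable (𝕜 U V) in
/-- The space `ℰ'(U, V*)` of compactly supported distributions: the topological dual of
`C^∞(U, V)`. -/
abbrev CompactDistribution : Type _ := SmoothFun 𝕜 U V →L[𝕜] 𝕜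

/-- `T` has order at most `N` as a distribution. -/
def HasOrderLE (T : CompactDistribution 𝕜 U V) (N : ℕ) : Prop :=
  ∀ K : CompactIn U, ∃ C : ℝ, ∀ u : SmoothFun 𝕜 U V, tsupport u ⊆ K.1 →
    ‖T u‖ ≤ C * ∑ k ∈ Finset.range (N + 1), derivSeminorm K k u

/-- The dual operator `T ↦ T ∘ L` on `ℰ'(U, V*)` of a continuous operator `L` on `C^∞(U, V)`. -/
def dualOperator (L : SmoothFun 𝕜 U V →L[𝕜] SmoothFun 𝕜 U V) :
    CompactDistribution 𝕜 U V →ₗ[𝕜] CompactDistribution 𝕜 U V where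
  toFun T := T.comp L
  map_add' _ _ := rfl
  map_smul' _ _ := rfl

/-! ### Jets -/

variable (𝕜 V) in
/-- The space `𝔪^N` of smooth functions that vanish to order `N` at `p`: all derivatives of order
less than `N` vanish at `p`. -/
def vanishing (p : U) (N : ℕ) : Submodule 𝕜 (SmoothFun 𝕜 U V) where
  carrier := {u | ∀ k < N, iteratedFDeriv ℝ k u p = 0}
  add_mem' {u v} hu hv k hk := by rw [u.iteratedFDeriv_add v k p.2, hu k hk, hv k hk, add_zero]
  zero_mem' k _ := by
    rw [SmoothFun.coe_zero, iteratedFDeriv_zero]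
    rfl
  smul_mem' c u hu k hk := by rw [u.iteratedFDeriv_smul c k p.2, hu k hk, smul_zero]

variable (𝕜 V) in
/-- The space `𝒫_N = C^∞(U, V) / 𝔪^(N+1)` of `N`-jets at `p`. -/
abbrev JetSpace (p : U) (N : ℕ) : Type _ := SmoothFun 𝕜 U V ⧸ vanishing 𝕜 V p (N + 1)

/-- The class `[u]_N` of `u` in `𝒫_N`. -/
def jet (p : U) (N : ℕ) (u : SmoothFun 𝕜 U V) : JetSpace 𝕜 V p N := Submodule.Quotient.mk u

/-! ### The operator `∇_X + A` -/

/-- The function `(∇_X + A) u`, for the connection `∇ = D + Γ` on the trivial bundle `U × V`,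
extended by zero. -/
def operatorFun (U : Opens E) (X : E → E) (Γ : E → E →L[ℝ] V →L[𝕜] V) (A : E → V →L[𝕜] V)
    (u : E → V) : E → V :=
  (U : Set E).indicator fun y => (fderiv ℝ u y (X y) + Γ y (X y) (u y)) + A y (u y)

section Operator

variable {X : E → E} {Γ : E → E →L[ℝ] V →L[𝕜] V} {A : E → V →L[𝕜] V}

/-- The zeroth order part of the operator, as a field of real endomorphisms. -/
def zerothOrder (X : E → E) (Γ : E → E →L[ℝ] V →L[𝕜] V) (A : E → V →L[𝕜] V) (y : E) :
    V →L[ℝ] V :=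
  ContinuousLinearMap.restrictScalarsL 𝕜 V V ℝ ℝ (Γ y (X y) + A y)

theorem contDiffOn_zerothOrder (hX : ContDiffOn ℝ ∞ X U) (hΓ : ContDiffOn ℝ ∞ Γ U)
    (hA : ContDiffOn ℝ ∞ A U) : ContDiffOn ℝ ∞ (zerothOrder X Γ A) U :=
  (ContinuousLinearMap.contDiff _).comp_contDiffOn ((hΓ.clm_apply hX).add hA)

theorem operatorFun_eqOn (u : E → V) :
    EqOn (operatorFun U X Γ A u)
      ((fun y => fderiv ℝ u y (X y)) + fun y => zerothOrder X Γ A y (u y)) U := by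
  intro y hy
  simp [operatorFun, indicator_of_mem hy, zerothOrder, add_assoc]

theorem contDiffOn_fderiv {u : E → V} (hu : ContDiffOn ℝ ∞ u U) :
    ContDiffOn ℝ ∞ (fderiv ℝ u) U :=
  hu.fderiv_of_isOpen U.isOpen (by simp)

theorem contDiffOn_operatorFun (hX : ContDiffOn ℝ ∞ X U) (hΓ : ContDiffOn ℝ ∞ Γ U)
    (hA : ContDiffOn ℝ ∞ A U) {u : E → V} (hu : ContDiffOn ℝ ∞ u U) :
    ContDiffOn ℝ ∞ (operatorFun U X Γ A u) U :=
  (((contDiffOn_fderiv hu).clm_apply hX).add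
    ((contDiffOn_zerothOrder hX hΓ hA).clm_apply hu)).congr (operatorFun_eqOn u)

theorem norm_iteratedFDeriv_operatorFun_le (hX : ContDiffOn ℝ ∞ X U) (hΓ : ContDiffOn ℝ ∞ Γ U)
    (hA : ContDiffOn ℝ ∞ A U) {u : E → V} (hu : ContDiffOn ℝ ∞ u U) (k : ℕ) {x : E} (hx : x ∈ U) :
    ‖iteratedFDeriv ℝ k (operatorFun U X Γ A u) x‖ ≤
      (∑ i ∈ Finset.range (k + 1), (k.choose i : ℝ) * ‖iteratedFDeriv ℝ (i + 1) u x‖ *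
        ‖iteratedFDeriv ℝ (k - i) X x‖) +
      ∑ i ∈ Finset.range (k + 1), (k.choose i : ℝ) *
        ‖iteratedFDeriv ℝ i (zerothOrder X Γ A) x‖ * ‖iteratedFDeriv ℝ (k - i) u x‖ := by
  have hk : (k : WithTop ℕ∞) ≤ ∞ := by exact_mod_cast le_top
  have hB := contDiffOn_zerothOrder hX hΓ hA
  have hD := contDiffOn_fderiv hu
  have h1 := norm_iteratedFDerivWithin_clm_apply hD hX U.isOpen.uniqueDiffOn hx hk
  have h2 := norm_iteratedFDerivWithin_clm_apply hB hu U.isOpen.uniqueDiffOn hx hk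
  simp only [fun (F : Type _) [NormedAddCommGroup F] [NormedSpace ℝ F] (m : ℕ) (f : E → F) =>
    iteratedFDerivWithin_of_isOpen (𝕜 := ℝ) (f := f) m U.isOpen hx] at h1 h2
  simp only [norm_iteratedFDeriv_fderiv] at h1
  have h3 : iteratedFDeriv ℝ k (operatorFun U X Γ A u) x =
      iteratedFDeriv ℝ k (fun y => fderiv ℝ u y (X y)) x +
        iteratedFDeriv ℝ k (fun y => zerothOrder X Γ A y (u y)) x := by
    rw [((Filter.eventuallyEq_of_mem (U.isOpen.mem_nhds hx)
      (operatorFun_eqOn u)).iteratedFDeriv ℝ k).eq_of_nhds]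
    exact iteratedFDeriv_add_apply
      (((hD.clm_apply hX).contDiffAt (U.isOpen.mem_nhds hx)).of_le hk)
      (((hB.clm_apply hu).contDiffAt (U.isOpen.mem_nhds hx)).of_le hk)
  rw [h3]
  exact (norm_add_le _ _).trans (add_le_add h1 h2)

/-- The operator `∇_X + A` on `C^∞(U, V)` as a linear map. -/
def operatorLinear (hX : ContDiffOn ℝ ∞ X U) (hΓ : ContDiffOn ℝ ∞ Γ U)
    (hA : ContDiffOn ℝ ∞ A U) : SmoothFun 𝕜 U V →ₗ[𝕜] SmoothFun 𝕜 U V where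
  toFun u := ⟨operatorFun U X Γ A u,
    contDiffOn_operatorFun hX hΓ hA u.contDiffOn, fun _ hx => indicator_of_notMem hx _⟩
  map_add' u v := by
    refine Subtype.ext (funext fun y => ?_)
    by_cases hy : y ∈ U
    · have hu := (u.contDiffAt hy).differentiableAt (by simp)
      have hv := (v.contDiffAt hy).differentiableAt (by simp)
      change operatorFun U X Γ A (⇑u + ⇑v) y =
        operatorFun U X Γ A u y + operatorFun U X Γ A v y
      simp only [operatorFun, indicator_of_mem (show y ∈ (U : Set E) from hy), fderiv_add hu hv,
        Pi.add_apply, map_add, _root_.add_apply]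
      abel
    · change operatorFun U X Γ A (⇑u + ⇑v) y =
        operatorFun U X Γ A u y + operatorFun U X Γ A v y
      simp only [operatorFun, indicator_of_notMem (show y ∉ (U : Set E) from hy), add_zero]
  map_smul' c u := by
    refine Subtype.ext (funext fun y => ?_)
    change operatorFun U X Γ A (c • ⇑u) y = c • operatorFun U X Γ A u y
    by_cases hy : y ∈ U
    · have hu := (u.contDiffAt hy).differentiableAt (by simp)
      simp only [operatorFun, indicator_of_mem (show y ∈ (U : Set E) from hy),
        fderiv_const_smul hu, Pi.smul_apply, map_smul, _root_.smul_apply, smul_add]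
    · simp only [operatorFun, indicator_of_notMem (show y ∉ (U : Set E) from hy), smul_zero]

theorem coe_operatorLinear (hX : ContDiffOn ℝ ∞ X U) (hΓ : ContDiffOn ℝ ∞ Γ U)
    (hA : ContDiffOn ℝ ∞ A U) (u : SmoothFun 𝕜 U V) :
    ⇑(operatorLinear hX hΓ hA u) = operatorFun U X Γ A u := rfl

theorem continuous_operatorLinear (hX : ContDiffOn ℝ ∞ X U) (hΓ : ContDiffOn ℝ ∞ Γ U)
    (hA : ContDiffOn ℝ ∞ A U) :
    Continuous (operatorLinear hX hΓ hA : SmoothFun 𝕜 U V →ₗ[𝕜] SmoothFun 𝕜 U V) := by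
  refine WithSeminorms.continuous_of_isBounded withSeminorms withSeminorms _
    (Seminorm.IsBounded.of_real ?_)
  rintro ⟨K, k⟩
  choose CX hX0 hCX using exists_bound K hX
  choose CB hB0 hCB using exists_bound K (contDiffOn_zerothOrder hX hΓ hA)
  let s : Finset (CompactIn U × ℕ) := (Finset.range (k + 2)).map
    ⟨fun j => (K, j), fun _ _ h => (Prod.ext_iff.1 h).2⟩
  refine ⟨s, (∑ i ∈ Finset.range (k + 1), (k.choose i : ℝ) * CX (k - i)) +
    ∑ i ∈ Finset.range (k + 1), (k.choose i : ℝ) * CB i, fun u => ?_⟩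
  have hS : 0 ≤ (s.sup (seminormFamily 𝕜 U V)) u := apply_nonneg _ _
  have hle : ∀ j < k + 2, ∀ x ∈ K.1,
      ‖iteratedFDeriv ℝ j u x‖ ≤ (s.sup (seminormFamily 𝕜 U V)) u := fun j hj x hx =>
    (le_derivSeminorm K j u hx).trans (Seminorm.le_finset_sup_apply
      (p := seminormFamily 𝕜 U V) (i := (K, j)) 
        (Finset.mem_map.2 ⟨j, Finset.mem_range.2 hj, rfl⟩))
  refine derivSeminorm_le K k _ (mul_nonneg (add_nonneg
    (Finset.sum_nonneg fun i _ => mul_nonneg (Nat.cast_nonneg _) (hX0 _))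
    (Finset.sum_nonneg fun i _ => mul_nonneg (Nat.cast_nonneg _) (hB0 _))) hS) fun x hx => ?_
  refine (norm_iteratedFDeriv_operatorFun_le hX hΓ hA u.contDiffOn k (K.2 hx)).trans ?_
  rw [add_mul, Finset.sum_mul, Finset.sum_mul]
  refine add_le_add (Finset.sum_le_sum fun i hi => ?_) (Finset.sum_le_sum fun i hi => ?_)
  · rw [mul_right_comm]
    exact mul_le_mul (mul_le_mul_of_nonneg_left (hCX _ x hx) (Nat.cast_nonneg _))
      (hle _ (by have := Finset.mem_range.1 hi; omega) x hx) (norm_nonneg _)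
      (mul_nonneg (Nat.cast_nonneg _) (hX0 _))
  · exact mul_le_mul (mul_le_mul_of_nonneg_left (hCB _ x hx) (Nat.cast_nonneg _))
      (hle _ (by omega) x hx) (norm_nonneg _) (mul_nonneg (Nat.cast_nonneg _) (hB0 _))

/-- The continuous operator `∇_X + A` on `C^∞(U, V)`. -/
def operator (hX : ContDiffOn ℝ ∞ X U) (hΓ : ContDiffOn ℝ ∞ Γ U) (hA : ContDiffOn ℝ ∞ A U) :
    SmoothFun 𝕜 U V →L[𝕜] SmoothFun 𝕜 U V :=
  ⟨operatorLinear hX hΓ hA, continuous_operatorLinear hX hΓ hA⟩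

theorem vanishing_le_comap (hX : ContDiffOn ℝ ∞ X U) (hΓ : ContDiffOn ℝ ∞ Γ U)
    (hA : ContDiffOn ℝ ∞ A U) {p : U} (hp : X p = 0) (N : ℕ) :
    vanishing 𝕜 V p N ≤ (vanishing 𝕜 V p N).comap (operatorLinear hX hΓ hA) := by
  intro u hu k hk
  refine norm_le_zero_iff.1 ((norm_iteratedFDeriv_operatorFun_le hX hΓ hA u.contDiffOn k
    p.2).trans (le_of_eq ?_))
  rw [Finset.sum_eq_zero, Finset.sum_eq_zero, add_zero]
  · intro i _
    rw [hu (k - i) (by omega), norm_zero, mul_zero]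
  · intro i hi
    rcases (Nat.lt_succ_iff.1 (Finset.mem_range.1 hi)).lt_or_eq with h | rfl
    · rw [hu (i + 1) (by omega), norm_zero, mul_zero, zero_mul]
    · rw [Nat.sub_self, norm_iteratedFDeriv_zero, hp, norm_zero, mul_zero]

/-- The operator `[∇_X + A]_N` on `𝒫_N` with `[∇_X + A]_N [u]_N = [(∇_X + A) u]_N`. -/
def jetOperator (hX : ContDiffOn ℝ ∞ X U) (hΓ : ContDiffOn ℝ ∞ Γ U) (hA : ContDiffOn ℝ ∞ A U)
    {p : U} (hp : X p = 0) (N : ℕ) : JetSpace 𝕜 V p N →ₗ[𝕜] JetSpace 𝕜 V p N :=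
  Submodule.mapQ _ _ (operatorLinear hX hΓ hA) (vanishing_le_comap hX hΓ hA hp (N + 1))

end Operator

end Smooth

end SourceOperator

end

/-! Write L = ∇_X + A. An eigendistribution T kills the range of L - λ, and the proof extracts
everything from this in two stages: a dynamical one that localizes T at p, and an algebraic one that
bounds its order.

Localization. Let φ be the flow of -X for a fixed time δ > 0 and let ρ be the parallel transport
belonging to L - λ. Integrating the transported section u over [0, δ] gives v with (L - λ)v = u -
ρ·(u ∘ φ), hence T(u) = T(Ru) for Ru = ρ·(u ∘ φ), and T(u) = T(R^m u) for all m. The values of R^m u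
near a point q depend only on u near φ^m(q). Iterates of φ move the compact set carrying T into any
given neighborhood of p, so T(u) = 0 as soon as u vanishes near p
(`apply_eq_zero_of_eventuallyEq_zero`). Two facts support this. The attraction is uniform on compact
sets and happens inside a compact subset of U (`exists_compact_hull`): a quadratic Lyapunov function
controls the flow near p, continuous dependence and a finite subcover do the rest. After a cutoff
that leaves this compact subset untouched, flow and transport are globally defined and smooth in the
initial value (`exists_transport`); smoothness comes from inverting a smooth map on a Banach space
of curves.

Order. A distribution supported at p kills the functions vanishing to some finite order M there
(`exists_forall_vanishing_apply_eq_zero`). Suppose T kills the functions vanishing to order k + 1.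
Modulo these, a function vanishing to order k is a homogeneous polynomial, on which L acts through
DX(p) and A(p) alone. Lifted to k-linear maps, this action is a sum of commuting operators, namely
DX(p) in each slot and A(p) on values, so its eigenvalues are among the sums of k eigenvalues μ_i
and one eigenvalue ρ. For k > N none of these is λ, so L - λ is surjective at the level of k-linear
maps (`isUnit_symbolOp_sub`) and T kills the functions vanishing to order k as well. Descending to k
= N + 1, T factors through N-jets. Conversely, every linear functional on jets is continuous, so it
defines a distribution, and the eigenvalue equations correspond. -/

namespace SourceOperator

/-! ### Smooth dependence of flows on the initial value -/

section Nemytskii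

universe u

variable {I : Type*} [TopologicalSpace I] [CompactSpace I]
  {F : Type u} [NormedAddCommGroup F] [NormedSpace ℝ F]
  {H : Type u} [NormedAddCommGroup H] [NormedSpace ℝ H]

variable (I F H) in
/-- A continuous family of continuous linear maps acts pointwise on continuous maps. -/
noncomputable def pointwiseApply : C(I, F →L[ℝ] H) →L[ℝ] C(I, F) →L[ℝ] C(I, H) :=
  LinearMap.mkContinuous₂ (E := C(I, F →L[ℝ] H)) (F := C(I, F)) (G := C(I, H))
    (LinearMap.mk₂ ℝ
      (fun (A : C(I, F →L[ℝ] H)) (γ : C(I, F)) =>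
        (⟨fun t => A t (γ t), A.continuous.clm_apply γ.continuous⟩ : C(I, H)))
      (fun _ _ _ => ContinuousMap.ext fun _ => rfl)
      (fun _ _ _ => ContinuousMap.ext fun _ => rfl)
      (fun A _ _ => ContinuousMap.ext fun t => (A t).map_add _ _)
      (fun c A _ => ContinuousMap.ext fun t => (A t).map_smul c _)) 1
    (fun A γ => by
      refine (ContinuousMap.norm_le _ (by positivity)).2 fun t => ?_
      rw [one_mul]
      exact (A t).le_of_opNorm_le_of_le (A.norm_coe_le_norm t) (γ.norm_coe_le_norm t))

theorem norm_pointwiseApply_le (A : C(I, F →L[ℝ] H)) {C : ℝ} (hC : 0 ≤ C)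
    (h : ∀ t, ‖A t‖ ≤ C) : ‖pointwiseApply I F H A‖ ≤ C := by
  refine ContinuousLinearMap.opNorm_le_bound _ hC fun γ => ?_
  refine (ContinuousMap.norm_le _ (by positivity)).2 fun t => ?_
  exact (A t).le_of_opNorm_le_of_le (h t) (γ.norm_coe_le_norm t)

/-- The range of γ is compact, so the derivative of G is uniformly continuous at it. The mean value
inequality on a ball of fixed radius around each γ(t) then bounds the remainder uniformly in t. -/
theorem hasFDerivAt_comp_continuousMap {G : F → H} (hG : ContDiff ℝ 1 G) (γ : C(I, F)) :
    HasFDerivAt (fun γ : C(I, F) => (⟨G, hG.continuous⟩ : C(F, H)).comp γ)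
      (pointwiseApply I F H
        ((⟨fderiv ℝ G, hG.continuous_fderiv (by simp)⟩ : C(F, F →L[ℝ] H)).comp γ)) γ := by
  have hdG : Continuous (fderiv ℝ G) := hG.continuous_fderiv (by simp)
  rw [hasFDerivAt_iff_isLittleO, Asymptotics.isLittleO_iff]
  intro ε hε
  have hK : IsCompact (range γ) := isCompact_range γ.continuous
  have h1 := hK.uniformContinuousAt_of_continuousAt (fderiv ℝ G) (fun a _ => hdG.continuousAt)
    (Metric.dist_mem_uniformity hε)
  obtain ⟨δ, hδ, h2⟩ := Metric.mem_uniformity_dist.1 h1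
  filter_upwards [Metric.ball_mem_nhds γ hδ] with η hη
  refine (ContinuousMap.norm_le _ (by positivity)).2 fun t => ?_
  have hηt : η t ∈ Metric.ball (γ t) δ :=
    (ContinuousMap.dist_apply_le_dist t).trans_lt hη
  have h3 := Convex.norm_image_sub_le_of_norm_fderiv_le' (𝕜 := ℝ) (f := G) (C := ε)
    (s := Metric.ball (γ t) δ) (φ := fderiv ℝ G (γ t))
    (fun x _ => (hG.differentiable (by simp)).differentiableAt)
    (fun x hx => by
      rw [← dist_eq_norm, dist_comm]
      exact (h2 (a := γ t) (b := x) (by rw [dist_comm]; exact hx) (mem_range_self t)).le)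
    (convex_ball _ _) (Metric.mem_ball_self hδ) hηt
  refine h3.trans (mul_le_mul_of_nonneg_left ?_ hε.le)
  exact (η - γ).norm_coe_le_norm t

/-- The derivative is again a composition operator, with G replaced by its derivative. The induction
therefore runs over all target spaces, and F and H share a universe so that F →L[ℝ] H is again an
admissible target. -/
theorem contDiff_comp_continuousMap_nat (n : ℕ) :
    ∀ {H : Type u} [NormedAddCommGroup H] [NormedSpace ℝ H] {G : F → H} (hG : ContDiff ℝ ∞ G),
      ContDiff ℝ n (fun γ : C(I, F) => (⟨G, hG.continuous⟩ : C(F, H)).comp γ) := by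
  induction n with
  | zero =>
    intro H _ _ G hG
    exact contDiff_zero.2 (continuous_iff_continuousAt.2 fun γ =>
      (hasFDerivAt_comp_continuousMap (hG.of_le (by exact_mod_cast le_top)) γ).continuousAt)
  | succ n ih =>
    intro H _ _ G hG
    have hG1 : ContDiff ℝ 1 G := hG.of_le (by exact_mod_cast le_top)
    have hdG : ContDiff ℝ ∞ (fderiv ℝ G) := hG.fderiv_right (by simp)
    rw [Nat.cast_add, Nat.cast_one, contDiff_succ_iff_hasFDerivAt]
    exact ⟨_, (pointwiseApply I F H).contDiff.comp (ih hdG), hasFDerivAt_comp_continuousMap hG1⟩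

/-- Composition with a smooth map is a smooth operation on continuous maps on a compact space. -/
theorem contDiff_comp_continuousMap {G : F → H} (hG : ContDiff ℝ ∞ G) :
    ContDiff ℝ ∞ (fun γ : C(I, F) => (⟨G, hG.continuous⟩ : C(F, H)).comp γ) :=
  contDiff_infty.2 fun n => contDiff_comp_continuousMap_nat n hG

end Nemytskii

section Flow

universe u

variable {F : Type u} [NormedAddCommGroup F]

/-- The extension of a continuous map on the unit interval that is constant outside. -/
noncomputable def extendCurve (γ : C(Icc (0 : ℝ) 1, F)) : ℝ → F := IccExtend zero_le_one γ

theorem continuous_extendCurve (γ : C(Icc (0 : ℝ) 1, F)) : Continuous (extendCurve γ) :=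
  γ.continuous.Icc_extend'

theorem extendCurve_of_mem (γ : C(Icc (0 : ℝ) 1, F)) {t : ℝ} (ht : t ∈ Icc (0 : ℝ) 1) :
    extendCurve γ t = γ ⟨t, ht⟩ := IccExtend_of_mem _ _ ht

theorem norm_extendCurve_le (γ : C(Icc (0 : ℝ) 1, F)) (t : ℝ) : ‖extendCurve γ t‖ ≤ ‖γ‖ :=
  γ.norm_coe_le_norm _

theorem intervalIntegrable_extendCurve (γ : C(Icc (0 : ℝ) 1, F)) (a b : ℝ) :
    IntervalIntegrable (extendCurve γ) MeasureTheory.volume a b :=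
  (continuous_extendCurve γ).intervalIntegrable a b

variable [NormedSpace ℝ F]

/-- The integral of a curve over `[0, a]`, as a continuous linear map. -/
noncomputable def integralUpTo (F : Type*) [NormedAddCommGroup F] [NormedSpace ℝ F]
    (a : ℝ) : C(Icc (0 : ℝ) 1, F) →L[ℝ] F :=
  LinearMap.mkContinuous
    { toFun := fun γ => ∫ s in 0..a, extendCurve γ s
      map_add' := fun γ η => by
        rw [← intervalIntegral.integral_add (intervalIntegrable_extendCurve _ _ _)
          (intervalIntegrable_extendCurve _ _ _)]
        rfl
      map_smul' := fun c γ => by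
        rw [RingHom.id_apply, ← intervalIntegral.integral_smul]
        rfl } |a|
    (fun γ => by
      have := intervalIntegral.norm_integral_le_of_norm_le_const (a := 0) (b := a)
        (f := extendCurve γ) (C := ‖γ‖) (fun x _ => norm_extendCurve_le γ x)
      simpa [mul_comm] using this)

variable [CompleteSpace F]

/-- The primitive of a curve on the unit interval, as a continuous linear map. -/
noncomputable def primitive (F : Type*) [NormedAddCommGroup F] [NormedSpace ℝ F] [CompleteSpace F] :
    C(Icc (0 : ℝ) 1, F) →L[ℝ] C(Icc (0 : ℝ) 1, F) :=
  LinearMap.mkContinuous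
    { toFun := fun γ => ⟨fun t => integralUpTo F t γ,
        (intervalIntegral.continuous_primitive (intervalIntegrable_extendCurve γ) 0).comp
          continuous_subtype_val⟩
      map_add' := fun γ η => ContinuousMap.ext fun t => (integralUpTo F t).map_add γ η
      map_smul' := fun c γ => ContinuousMap.ext fun t => (integralUpTo F t).map_smul c γ } 1
    (fun γ => by
      refine (ContinuousMap.norm_le _ (by positivity)).2 fun t => ?_
      have := intervalIntegral.norm_integral_le_of_norm_le_const (a := 0) (b := t)
        (f := extendCurve γ) (C := ‖γ‖) (fun x _ => norm_extendCurve_le γ x)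
      refine this.trans ?_
      rw [sub_zero, abs_of_nonneg t.2.1, mul_comm]
      exact mul_le_mul_of_nonneg_right t.2.2 (norm_nonneg _))

theorem primitive_apply (γ : C(Icc (0 : ℝ) 1, F)) (t : Icc (0 : ℝ) 1) :
    primitive F γ t = ∫ s in 0..(t : ℝ), extendCurve γ s := rfl

theorem norm_primitive_le : ‖primitive F‖ ≤ 1 :=
  LinearMap.mkContinuous_norm_le _ zero_le_one _

/-- The constant curves, as a continuous linear map. -/
noncomputable def constCurve (F : Type*) [NormedAddCommGroup F] [NormedSpace ℝ F] :
    F →L[ℝ] C(Icc (0 : ℝ) 1, F) :=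
  LinearMap.mkContinuous
    { toFun := fun z => ContinuousMap.const _ z
      map_add' := fun _ _ => rfl
      map_smul' := fun _ _ => rfl } 1
    (fun z => by
      refine (ContinuousMap.norm_le _ (by positivity)).2 fun t => ?_
      exact (one_mul ‖z‖).ge)

/-- The solutions on the unit time interval of an autonomous smooth differential equation with
Lipschitz constant at most `1/2` depend smoothly on the initial value. -/
theorem exists_smooth_flow {Y : F → F} (hY : ContDiff ℝ ∞ Y) (hL : LipschitzWith (1 / 2) Y) :
    ∃ S : F → C(Icc (0 : ℝ) 1, F), ContDiff ℝ ∞ S ∧ ∀ z, extendCurve (S z) 0 = z ∧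
      ∀ t ∈ Icc (0 : ℝ) 1,
        HasDerivWithinAt (extendCurve (S z)) (Y (extendCurve (S z) t)) (Icc 0 1) t := by
  let YC : C(F, F) := ⟨Y, hY.continuous⟩
  let YN : C(Icc (0 : ℝ) 1, F) → C(Icc (0 : ℝ) 1, F) := fun γ => YC.comp γ
  have hYN : ContDiff ℝ ∞ YN := contDiff_comp_continuousMap hY
  -- By the integral equation, γ solves the initial value problem from z exactly if Θ(γ) is the
  -- constant curve z. As Y has Lipschitz constant 1/2, Θ differs from the identity by a contraction
  -- and is a homeomorphism; it remains to see that its inverse is smooth.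
  let Θ : C(Icc (0 : ℝ) 1, F) → C(Icc (0 : ℝ) 1, F) := fun γ => γ - primitive F (YN γ)
  have hΘ : ContDiff ℝ ∞ Θ := contDiff_id.sub ((primitive F).contDiff.comp hYN)
  have hlip : ∀ γ η, ‖YN γ - YN η‖ ≤ 1 / 2 * ‖γ - η‖ := fun γ η => by
    refine (ContinuousMap.norm_le _ (by positivity)).2 fun t => ?_
    have h1 := hL.dist_le_mul (γ t) (η t)
    rw [dist_eq_norm, dist_eq_norm] at h1
    refine h1.trans ?_
    simpa using (γ - η).norm_coe_le_norm t
  have happ : ApproximatesLinearOn Θ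
      (ContinuousLinearEquiv.refl ℝ C(Icc (0 : ℝ) 1, F) :
        C(Icc (0 : ℝ) 1, F) →L[ℝ] C(Icc (0 : ℝ) 1, F)) univ (1 / 2) := by
    intro γ _ η _
    have h1 : Θ γ - Θ η - (γ - η) = - primitive F (YN γ - YN η) := by
      simp only [Θ, map_sub]; abel
    have h2 := (primitive F).le_of_opNorm_le norm_primitive_le (YN γ - YN η)
    change ‖Θ γ - Θ η - (γ - η)‖ ≤ _
    rw [h1, norm_neg]
    have h3 := hlip γ η
    rw [one_mul] at h2
    simpa using h2.trans h3
  have hc : Subsingleton C(Icc (0 : ℝ) 1, F) ∨ (1 / 2 : NNReal) <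
      ‖((ContinuousLinearEquiv.refl ℝ C(Icc (0 : ℝ) 1, F)).symm :
        C(Icc (0 : ℝ) 1, F) →L[ℝ] C(Icc (0 : ℝ) 1, F))‖₊⁻¹ := by
    rcases subsingleton_or_nontrivial C(Icc (0 : ℝ) 1, F) with h | h
    · exact Or.inl h
    · right
      have : ‖((ContinuousLinearEquiv.refl ℝ C(Icc (0 : ℝ) 1, F)).symm :
          C(Icc (0 : ℝ) 1, F) →L[ℝ] C(Icc (0 : ℝ) 1, F))‖₊ = 1 := by
        ext
        exact ContinuousLinearMap.norm_id
      rw [this]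
      norm_num
  let h : C(Icc (0 : ℝ) 1, F) ≃ₜ C(Icc (0 : ℝ) 1, F) := happ.toHomeomorph Θ hc
  have hh : ∀ γ, h γ = Θ γ := fun _ => rfl
  have hdY : Continuous (fderiv ℝ Y) := hY.continuous_fderiv (by simp)
  let D : C(Icc (0 : ℝ) 1, F) → C(Icc (0 : ℝ) 1, F) →L[ℝ] C(Icc (0 : ℝ) 1, F) := fun γ =>
    primitive F ∘L pointwiseApply _ F F ((⟨fderiv ℝ Y, hdY⟩ : C(F, F →L[ℝ] F)).comp γ)
  -- The derivative of Θ at γ is 1 - D(γ), invertible by the Neumann series. This is what smoothness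
  -- of the inverse homeomorphism requires.
  have hD : ∀ γ, ‖D γ‖ < 1 := fun γ => by
    have h1 := norm_pointwiseApply_le ((⟨fderiv ℝ Y, hdY⟩ : C(F, F →L[ℝ] F)).comp γ)
      (C := 1 / 2) (by norm_num) (fun t => by
        simpa using norm_fderiv_le_of_lipschitz ℝ (x₀ := γ t) hL)
    have h2 := ContinuousLinearMap.opNorm_comp_le (primitive F)
      (pointwiseApply _ F F ((⟨fderiv ℝ Y, hdY⟩ : C(F, F →L[ℝ] F)).comp γ))
    refine h2.trans_lt ((mul_le_mul (norm_primitive_le (F := F)) h1 ?_ zero_le_one).trans_lt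
      (by norm_num))
    exact norm_nonneg (pointwiseApply (Icc (0 : ℝ) 1) F F _)
  have hder : ∀ γ, HasFDerivAt h
      ((ContinuousLinearEquiv.unitsEquiv ℝ _ (Units.oneSub (D γ) (hD γ)) : _ ≃L[ℝ] _) :
        C(Icc (0 : ℝ) 1, F) →L[ℝ] C(Icc (0 : ℝ) 1, F)) γ := fun γ => by
    have h1 := (hasFDerivAt_id γ).sub ((primitive F).hasFDerivAt.comp γ
      (hasFDerivAt_comp_continuousMap (hY.of_le (by exact_mod_cast le_top)) γ))
    exact h1
  have hsymm : ContDiff ℝ ∞ h.symm := h.contDiff_symm hder hΘ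
  refine ⟨fun z => h.symm (ContinuousMap.const _ z),
    hsymm.comp (constCurve F).contDiff, fun z => ?_⟩
  set γ := h.symm (ContinuousMap.const _ z) with hγ
  have h1 : γ - primitive F (YN γ) = ContinuousMap.const _ z := by
    rw [← h.apply_symm_apply (ContinuousMap.const _ z), ← hγ, hh]
  have h2 : ∀ t ∈ Icc (0 : ℝ) 1, extendCurve γ t = z + ∫ s in 0..t, Y (extendCurve γ s) := by
    intro t ht
    rw [extendCurve_of_mem _ ht]
    have := congrArg (fun η => η ⟨t, ht⟩) h1
    simp only [ContinuousMap.sub_apply, primitive_apply, ContinuousMap.const_apply] at this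
    rw [← this]
    exact (sub_add_cancel _ _).symm
  refine ⟨by rw [h2 0 (by simp)]; simp, fun t ht => ?_⟩
  have hcont : Continuous fun s => Y (extendCurve γ s) := hY.continuous.comp (continuous_extendCurve γ)
  have h3 : HasDerivAt (fun t => z + ∫ s in 0..t, Y (extendCurve γ s)) (Y (extendCurve γ t)) t :=
    (intervalIntegral.integral_hasDerivAt_right (hcont.intervalIntegrable _ _)
      (hcont.stronglyMeasurableAtFilter _ _) hcont.continuousAt).const_add z
  exact h3.hasDerivWithinAt.congr h2 (h2 t ht)

end Flow

/-! ### Transport along the flow of a compactly supported vector field -/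

section Transport

universe u

/-- Both curves stay in one closed ball, which is compact and convex, so G is Lipschitz there and
the standard uniqueness theorem applies without a global Lipschitz bound. -/
theorem eqOn_of_hasDerivWithinAt_of_contDiff {F : Type*} [NormedAddCommGroup F] [NormedSpace ℝ F]
    [FiniteDimensional ℝ F] {G : F → F} (hG : ContDiff ℝ ∞ G) {a b : ℝ} {f g : ℝ → F}
    (hf : ContinuousOn f (Icc a b)) (hg : ContinuousOn g (Icc a b))
    (hf' : ∀ t ∈ Ico a b, HasDerivWithinAt f (G (f t)) (Ici t) t)
    (hg' : ∀ t ∈ Ico a b, HasDerivWithinAt g (G (g t)) (Ici t) t) (h : f a = g a) :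
    EqOn f g (Icc a b) := by
  obtain ⟨R, hR⟩ := isCompact_Icc.exists_bound_of_continuousOn hf
  obtain ⟨R', hR'⟩ := isCompact_Icc.exists_bound_of_continuousOn hg
  have hC : IsCompact (Metric.closedBall (0 : F) (max R R')) := isCompact_closedBall _ _
  obtain ⟨K, hK⟩ := (hG.of_le (show (1 : WithTop ℕ∞) ≤ ∞ by exact_mod_cast le_top)).contDiffOn
    |>.exists_lipschitzOnWith one_ne_zero (convex_closedBall (0 : F) (max R R')) hC
  refine ODE_solution_unique_of_mem_Icc_right (v := fun _ => G) (K := K)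
    (s := fun _ => Metric.closedBall (0 : F) (max R R')) (fun _ _ => hK) hf hf' (fun t ht => ?_)
    hg hg' (fun t ht => ?_) h
  · exact mem_closedBall_zero_iff.2 ((hR t (Ico_subset_Icc_self ht)).trans (le_max_left _ _))
  · exact mem_closedBall_zero_iff.2 ((hR' t (Ico_subset_Icc_self ht)).trans (le_max_right _ _))

theorem hasDerivWithinAt_Ici_of_Icc {F : Type*} [NormedAddCommGroup F] [NormedSpace ℝ F]
    {f : ℝ → F} {f' : F} {a b t : ℝ} (ht : t ∈ Ico a b) (h : HasDerivWithinAt f f' (Icc a b) t) :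
    HasDerivWithinAt f f' (Ici t) t :=
  h.mono_of_mem_nhdsWithin (mem_of_superset (Icc_mem_nhdsGE ht.2) (Icc_subset_Icc_left ht.1))

theorem hasDerivWithinAt_fst {F G : Type*} [NormedAddCommGroup F] [NormedSpace ℝ F]
    [NormedAddCommGroup G] [NormedSpace ℝ G] {f : ℝ → F × G} {f' : F × G} {s : Set ℝ} {t : ℝ}
    (h : HasDerivWithinAt f f' s t) : HasDerivWithinAt (fun x => (f x).1) f'.1 s t :=
  (ContinuousLinearMap.fst ℝ F G).hasFDerivAt.comp_hasDerivWithinAt t h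

theorem hasDerivWithinAt_snd {F G : Type*} [NormedAddCommGroup F] [NormedSpace ℝ F]
    [NormedAddCommGroup G] [NormedSpace ℝ G] {f : ℝ → F × G} {f' : F × G} {s : Set ℝ} {t : ℝ}
    (h : HasDerivWithinAt f f' s t) : HasDerivWithinAt (fun x => (f x).2) f'.2 s t :=
  (ContinuousLinearMap.snd ℝ F G).hasFDerivAt.comp_hasDerivWithinAt t h

variable {E : Type} [NormedAddCommGroup E] [NormedSpace ℝ E] [FiniteDimensional ℝ E]
  {V : Type u} [NormedAddCommGroup V] [NormedSpace ℝ V] [FiniteDimensional ℝ V]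

/-- The vector field on `E × End V` whose flow is the flow of `-X` together with the parallel
transport of `X + B`. -/
def transportField (X : E → E) (B : E → V →L[ℝ] V) (z : E × (V →L[ℝ] V)) : E × (V →L[ℝ] V) :=
  (-X z.1, -(z.2 ∘L B z.1))

omit [FiniteDimensional ℝ E] [FiniteDimensional ℝ V] in
theorem contDiff_transportField {X : E → E} {B : E → V →L[ℝ] V} (hX : ContDiff ℝ ∞ X)
    (hB : ContDiff ℝ ∞ B) : ContDiff ℝ ∞ (transportField X B) :=
  (hX.comp contDiff_fst).neg.prodMk (contDiff_snd.clm_comp (hB.comp contDiff_fst)).neg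

/-- A smooth family of solution curves of the transport field on the unit time interval. -/
structure IsTransport (X : E → E) (B : E → V →L[ℝ] V)
    (S : E → C(Icc (0 : ℝ) 1, E × (V →L[ℝ] V))) : Prop where
  contDiff : ContDiff ℝ ∞ S
  initial : ∀ q, extendCurve (S q) 0 = (q, ContinuousLinearMap.id ℝ V)
  deriv : ∀ q, ∀ t ∈ Icc (0 : ℝ) 1, HasDerivWithinAt (extendCurve (S q))
    (transportField X B (extendCurve (S q) t)) (Icc 0 1) t

/-- The transport field need not be globally Lipschitz in both variables together, because of the
product in its second component. That component is cut off around the identity, and rescaling by ε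
achieves the Lipschitz constant 1/2. For small ε the solutions from the identity do not leave the
region where the cutoff is 1, so they solve the original equation. -/
theorem exists_isTransport {X : E → E} {B : E → V →L[ℝ] V} (hX : ContDiff ℝ ∞ X)
    (hXc : HasCompactSupport X) (hB : ContDiff ℝ ∞ B) (hBc : HasCompactSupport B) :
    ∃ ε : ℝ, 0 < ε ∧ ∃ S, IsTransport (fun x => ε • X x) (fun x => ε • B x) S := by
  let θ : ContDiffBump (ContinuousLinearMap.id ℝ V) := ⟨1, 2, one_pos, one_lt_two⟩
  let W : E × (V →L[ℝ] V) → V →L[ℝ] V := fun z => θ z.2 • (z.2 ∘L B z.1)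
  have hW : ContDiff ℝ ∞ W :=
    (θ.contDiff.comp contDiff_snd).smul (contDiff_snd.clm_comp (hB.comp contDiff_fst))
  have hWc : HasCompactSupport W := by
    refine HasCompactSupport.intro (hBc.prod θ.hasCompactSupport) fun z hz => ?_
    rw [mem_prod, not_and_or] at hz
    rcases hz with hz | hz
    · simp [W, image_eq_zero_of_notMem_tsupport hz]
    · simp [W, image_eq_zero_of_notMem_tsupport hz]
  obtain ⟨K₁, hK₁⟩ := ContDiff.lipschitzWith_of_hasCompactSupport hXc hX (by simp)
  obtain ⟨K₂, hK₂⟩ := ContDiff.lipschitzWith_of_hasCompactSupport hWc hW (by simp)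
  obtain ⟨C, hC⟩ := hWc.exists_bound_of_continuous hW.continuous
  have hC0 : 0 ≤ C := (norm_nonneg _).trans (hC 0)
  -- M dominates the two Lipschitz constants and the bound C on the speed of the second component;
  -- the summand 1 makes it positive.
  let M : ℝ := K₁ + K₂ + C + 1
  have hM : 0 < M := by positivity
  let ε : ℝ := 1 / (2 * M)
  have hε : 0 < ε := by positivity
  have hεM : ε * M = 1 / 2 := by simp only [ε]; field_simp
  let Z : E × (V →L[ℝ] V) → E × (V →L[ℝ] V) := fun z => (-(ε • X z.1), -(ε • W z))
  have hZ : ContDiff ℝ ∞ Z :=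
    ((hX.comp contDiff_fst).const_smul ε).neg.prodMk (hW.const_smul ε).neg
  have hZL : LipschitzWith (1 / 2) Z := by
    refine LipschitzWith.of_dist_le_mul fun z w => ?_
    rw [Prod.dist_eq]
    simp only [Z, dist_neg_neg]
    have h1 := hK₁.dist_le_mul z.1 w.1
    have h2 := hK₂.dist_le_mul z w
    have h3 : dist z.1 w.1 ≤ dist z w := le_max_left _ _
    have h0 : 0 ≤ dist z w := dist_nonneg
    have hK1M : (K₁ : ℝ) ≤ M := by
      have : (0 : ℝ) ≤ K₂ := K₂.2
      simp only [M]; linarith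
    have hK2M : (K₂ : ℝ) ≤ M := by
      have : (0 : ℝ) ≤ K₁ := K₁.2
      simp only [M]; linarith
    have h4 : ε * (M * dist z w) = 1 / 2 * dist z w := by rw [← mul_assoc, hεM]
    have h5 : ((1 / 2 : NNReal) : ℝ) = 1 / 2 := by norm_num
    have h6 := dist_smul₀ ε (W z) (W w)
    rw [h5, ← h4, dist_smul₀, h6, Real.norm_of_nonneg hε.le]
    refine max_le (mul_le_mul_of_nonneg_left ?_ hε.le) (mul_le_mul_of_nonneg_left ?_ hε.le)
    · exact h1.trans ((mul_le_mul_of_nonneg_left h3 K₁.2).trans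
        (mul_le_mul_of_nonneg_right hK1M h0))
    · exact h2.trans (mul_le_mul_of_nonneg_right hK2M h0)
  obtain ⟨S, hS, hS'⟩ := exists_smooth_flow hZ hZL
  refine ⟨ε, hε, fun q => S (q, ContinuousLinearMap.id ℝ V),
    hS.comp (contDiff_id.prodMk contDiff_const), fun q => (hS' _).1, fun q t ht => ?_⟩
  set γ := extendCurve (S (q, ContinuousLinearMap.id ℝ V)) with hγ
  have hder := (hS' (q, ContinuousLinearMap.id ℝ V)).2
  -- The second component moves with speed at most ε C ≤ 1/2, so up to time 1 it stays in the unit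
  -- ball around the identity, where θ = 1.
  have hsnd : ‖(γ t).2 - ContinuousLinearMap.id ℝ V‖ ≤ 1 := by
    have h1 : ∀ s ∈ Icc (0 : ℝ) 1, HasDerivWithinAt (fun s => (γ s).2) (-(ε • W (γ s)))
        (Icc 0 1) s := fun s hs => hasDerivWithinAt_snd (hder s hs)
    have h2 := norm_image_sub_le_of_norm_deriv_le_segment' (C := ε * C) h1 (fun s _ => by
      rw [norm_neg, norm_smul, Real.norm_of_nonneg hε.le]
      exact mul_le_mul_of_nonneg_left (hC _) hε.le) t ht
    have h3 : γ 0 = (q, ContinuousLinearMap.id ℝ V) := (hS' _).1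
    rw [h3] at h2
    refine h2.trans ?_
    have h4 : ε * C ≤ 1 / 2 := by
      rw [← hεM]
      refine mul_le_mul_of_nonneg_left ?_ hε.le
      have h5 : (0 : ℝ) ≤ K₁ := K₁.2
      have h6 : (0 : ℝ) ≤ K₂ := K₂.2
      simp only [M]; linarith
    have h5 : 0 ≤ ε * C := by positivity
    nlinarith [ht.1, ht.2]
  have hθ : θ (γ t).2 = 1 := θ.one_of_mem_closedBall (by
    rw [mem_closedBall_iff_norm]; exact hsnd)
  have h7 := hder t ht
  have h8 : Z (γ t) = transportField (fun x => ε • X x) (fun x => ε • B x) (γ t) := by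
    simp [transportField, Z, W, hθ]
  rwa [h8] at h7

variable {X : E → E} {B : E → V →L[ℝ] V} {S : E → C(Icc (0 : ℝ) 1, E × (V →L[ℝ] V))}

omit [FiniteDimensional ℝ E] [FiniteDimensional ℝ V] in
theorem IsTransport.hasDerivWithinAt_Ici (hS : IsTransport X B S) (q : E) {t : ℝ}
    (ht : t ∈ Ico (0 : ℝ) 1) : HasDerivWithinAt (extendCurve (S q))
      (transportField X B (extendCurve (S q) t)) (Ici t) t :=
  hasDerivWithinAt_Ici_of_Icc ht (hS.deriv q t (Ico_subset_Icc_self ht))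

omit [FiniteDimensional ℝ V] in
theorem IsTransport.eq_curve (hS : IsTransport X B S) (hX : ContDiff ℝ ∞ X) {γ : ℝ → E} {t : ℝ}
    (ht : t ∈ Icc (0 : ℝ) 1)
    (hγ : ∀ s ∈ Icc (0 : ℝ) 1, HasDerivWithinAt γ (-X (γ s)) (Icc 0 1) s) :
    (extendCurve (S (γ 0)) t).1 = γ t := by
  refine eqOn_of_hasDerivWithinAt_of_contDiff (G := fun x => -X x) hX.neg (a := 0) (b := 1)
    (f := fun t => (extendCurve (S (γ 0)) t).1)
    (continuous_extendCurve _).fst.continuousOn (fun s hs => (hγ s hs).continuousWithinAt)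
    (fun s hs => hasDerivWithinAt_fst (hS.hasDerivWithinAt_Ici _ hs))
    (fun s hs => hasDerivWithinAt_Ici_of_Icc hs (hγ s (Ico_subset_Icc_self hs))) ?_ ht
  rw [hS.initial]

/-- The flow property and the cocycle law of the transport. Both sides solve the same equation in t,
since composing with a fixed endomorphism on the left preserves solutions. Times are at most 1/2
because their sum must stay in [0, 1]. -/
theorem IsTransport.add (hS : IsTransport X B S) (hX : ContDiff ℝ ∞ X) (hB : ContDiff ℝ ∞ B)
    (q : E) {h t : ℝ} (hh : h ∈ Icc (0 : ℝ) (1 / 2)) (ht : t ∈ Icc (0 : ℝ) (1 / 2)) :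
    extendCurve (S q) (t + h) = ((extendCurve (S (extendCurve (S q) h).1) t).1,
      (extendCurve (S q) h).2 ∘L (extendCurve (S (extendCurve (S q) h).1) t).2) := by
  set z := extendCurve (S q) h with hz
  refine eqOn_of_hasDerivWithinAt_of_contDiff (contDiff_transportField hX hB)
    (f := fun t => extendCurve (S q) (t + h))
    (g := fun t => ((extendCurve (S z.1) t).1, z.2 ∘L (extendCurve (S z.1) t).2))
    ((continuous_extendCurve _).comp (continuous_id.add continuous_const)).continuousOn
    (Continuous.continuousOn ?_) (fun s hs => ?_) (fun s hs => ?_) ?_ ht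
  · exact (continuous_extendCurve _).fst.prodMk
      (continuous_const.clm_comp (continuous_extendCurve _).snd)
  · have h1 : s + h ∈ Ico (0 : ℝ) 1 := ⟨by linarith [hs.1, hh.1], by linarith [hs.2, hh.2]⟩
    have h2 := (hS.hasDerivWithinAt_Ici q h1).scomp s
      (((hasDerivAt_id s).add_const h).hasDerivWithinAt (s := Ici s))
      (fun r hr => by simpa using hr)
    simpa [Function.comp_def] using h2
  · have h1 : s ∈ Ico (0 : ℝ) 1 := ⟨hs.1, by linarith [hs.2]⟩
    have h2 := hS.hasDerivWithinAt_Ici z.1 h1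
    have h3 := ((ContinuousLinearMap.compL ℝ V V V z.2).hasFDerivAt.comp_hasDerivWithinAt s
      (hasDerivWithinAt_snd h2))
    have h4 := (hasDerivWithinAt_fst h2).prodMk h3
    simpa [transportField, ContinuousLinearMap.comp_assoc] using h4
  · simp [hS.initial, ← hz]

/-- For the transport by `X + B` over a time `1/2`, the difference between a section and the
transported section is in the range of `X + B`. -/
theorem IsTransport.exists_solution (hS : IsTransport X B S) (hX : ContDiff ℝ ∞ X)
    (hB : ContDiff ℝ ∞ B) {u : E → V} (hu : ContDiff ℝ ∞ u) :
    ∃ v : E → V, ContDiff ℝ ∞ v ∧ ∀ q, fderiv ℝ v q (X q) + B q (v q) =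
      u q - (extendCurve (S q) (1 / 2)).2 (u (extendCurve (S q) (1 / 2)).1) := by
  let G : E × (V →L[ℝ] V) → V := fun z => z.2 (u z.1)
  have hG : ContDiff ℝ ∞ G := contDiff_snd.clm_apply (hu.comp contDiff_fst)
  -- v is the time integral over [0, 1/2] of the transported section u.
  let v : E → V := fun q => integralUpTo V (1 / 2)
    ((⟨G, hG.continuous⟩ : C(E × (V →L[ℝ] V), V)).comp (S q))
  have hv : ContDiff ℝ ∞ v :=
    (integralUpTo V (1 / 2)).contDiff.comp ((contDiff_comp_continuousMap hG).comp hS.contDiff)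
  have hvq : ∀ q, v q = ∫ s in (0 : ℝ)..(1 / 2), G (extendCurve (S q) s) := fun q => rfl
  refine ⟨v, hv, fun q => ?_⟩
  have hcont : Continuous fun s => G (extendCurve (S q) s) :=
    hG.continuous.comp (continuous_extendCurve _)
  -- By the cocycle law, transporting v by time h shifts the interval of integration by h. The
  -- one-sided derivative at h = 0 gives -(Xv + Bv) on the left and the difference of the integrand
  -- at the end points on the right.
  have key : ∀ h ∈ Icc (0 : ℝ) (1 / 2), (extendCurve (S q) h).2 (v (extendCurve (S q) h).1) =
      (∫ s in (0 : ℝ)..(h + 1 / 2), G (extendCurve (S q) s)) -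
        ∫ s in (0 : ℝ)..h, G (extendCurve (S q) s) := by
    intro h hh
    rw [intervalIntegral.integral_interval_sub_left (hcont.intervalIntegrable _ _)
      (hcont.intervalIntegrable _ _), hvq,
      ← ContinuousLinearMap.intervalIntegral_comp_comm (f := fun s => G (extendCurve _ s)) _
        ((hG.continuous.comp (continuous_extendCurve _)).intervalIntegrable _ _)]
    have h1 := intervalIntegral.integral_comp_add_right (a := 0) (b := 1 / 2)
      (fun s => G (extendCurve (S q) s)) h
    rw [zero_add, add_comm (1 / 2) h] at h1
    rw [← h1]
    refine intervalIntegral.integral_congr fun s hs => ?_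
    rw [uIcc_of_le (by norm_num)] at hs
    rw [hS.add hX hB q hh hs]
    rfl
  have h0 : (0 : ℝ) ∈ Icc (0 : ℝ) 1 := by simp
  have hd := hS.deriv q 0 h0
  rw [hS.initial] at hd
  have hL : HasDerivWithinAt (fun h => (extendCurve (S q) h).2 (v (extendCurve (S q) h).1))
      (-(B q (v q)) - fderiv ℝ v q (X q)) (Icc 0 1) 0 := by
    have hv' : HasFDerivAt v (fderiv ℝ v q) (extendCurve (S q) 0).1 := by
      rw [hS.initial]
      exact (hv.differentiable (by simp) q).hasFDerivAt
    have h1 := hv'.comp_hasDerivWithinAt (0 : ℝ) (hasDerivWithinAt_fst hd)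
    have h2 := (hasDerivWithinAt_snd hd).clm_apply h1
    have h3 : -(B q (v q)) - fderiv ℝ v q (X q) =
        (transportField X B (q, ContinuousLinearMap.id ℝ V)).2 (v (extendCurve (S q) 0).1) +
          (extendCurve (S q) 0).2
            (fderiv ℝ v q (transportField X B (q, ContinuousLinearMap.id ℝ V)).1) := by
      simp [transportField, hS.initial, sub_eq_add_neg]
    rw [h3]
    exact h2
  have hint : ∀ t, HasDerivAt (fun t => ∫ s in (0 : ℝ)..t, G (extendCurve (S q) s))
      (G (extendCurve (S q) t)) t := fun t =>
    intervalIntegral.integral_hasDerivAt_right (hcont.intervalIntegrable _ _)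
      (hcont.stronglyMeasurableAtFilter _ _) hcont.continuousAt
  have hR : HasDerivAt (fun h => (∫ s in (0 : ℝ)..(h + 1 / 2), G (extendCurve (S q) s)) -
      ∫ s in (0 : ℝ)..h, G (extendCurve (S q) s))
      (G (extendCurve (S q) (1 / 2)) - G (extendCurve (S q) 0)) 0 := by
    have h1 : HasDerivAt (fun t => ∫ s in (0 : ℝ)..t, G (extendCurve (S q) s))
      (G (extendCurve (S q) (1 / 2))) (0 + 1 / 2) := by
      rw [zero_add]
      exact hint _
    exact (h1.comp_add_const 0 (1 / 2)).sub (hint 0)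
  have h1 := (hL.mono (Icc_subset_Icc_right (by norm_num : (1 / 2 : ℝ) ≤ 1)))
  have h2 := (hR.hasDerivWithinAt (s := Icc 0 (1 / 2))).congr key (key 0 (by simp))
  have h3 := (uniqueDiffOn_Icc (by norm_num : (0 : ℝ) < 1 / 2) 0 (by simp)).eq_deriv _ h1 h2
  simp only [G, hS.initial, ContinuousLinearMap.id_apply] at h3
  rw [← neg_inj, neg_sub, ← h3]
  abel

/-- The evaluation of curves at a time, as a continuous linear map. -/
noncomputable def evalCurve (F : Type*) [NormedAddCommGroup F] [NormedSpace ℝ F]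
    (t : Icc (0 : ℝ) 1) : C(Icc (0 : ℝ) 1, F) →L[ℝ] F :=
  LinearMap.mkContinuous
    { toFun := fun γ => γ t
      map_add' := fun _ _ => rfl
      map_smul' := fun _ _ => rfl } 1
    (fun γ => (γ.norm_coe_le_norm t).trans (one_mul ‖γ‖).ge)

/-- The transport of sections along the flow of a compactly supported vector field. -/
theorem exists_transport {X : E → E} {B : E → V →L[ℝ] V} (hX : ContDiff ℝ ∞ X)
    (hXc : HasCompactSupport X) (hB : ContDiff ℝ ∞ B) (hBc : HasCompactSupport B) :
    ∃ δ : ℝ, 0 < δ ∧ ∃ (φ : E → E) (ρ : E → V →L[ℝ] V), ContDiff ℝ ∞ φ ∧ ContDiff ℝ ∞ ρ ∧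
      (∀ u : E → V, ContDiff ℝ ∞ u → ∃ v : E → V, ContDiff ℝ ∞ v ∧
        ∀ q, fderiv ℝ v q (X q) + B q (v q) = u q - ρ q (u (φ q))) ∧
      ∀ γ : ℝ → E, (∀ s ≥ 0, HasDerivWithinAt γ (-X (γ s)) (Ici 0) s) → φ (γ 0) = γ δ := by
  obtain ⟨ε, hε, S, hS⟩ := exists_isTransport hX hXc hB hBc
  have h12 : (1 / 2 : ℝ) ∈ Icc (0 : ℝ) 1 := by norm_num
  let ev := evalCurve (E × (V →L[ℝ] V)) ⟨1 / 2, h12⟩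
  have hev : ∀ q, extendCurve (S q) (1 / 2) = ev (S q) := fun q => extendCurve_of_mem _ h12
  have hevS : ContDiff ℝ ∞ fun q => ev (S q) :=
    ev.contDiff.comp hS.contDiff
  -- S transports along ε • X and is evaluated at time 1/2, which is time ε/2 for X itself.
  refine ⟨ε * (1 / 2), by positivity, fun q => (ev (S q)).1, fun q => (ev (S q)).2,
    hevS.fst, hevS.snd, fun u hu => ?_, fun γ hγ => ?_⟩
  · obtain ⟨v, hv, hvq⟩ := hS.exists_solution (hX.const_smul ε) (hB.const_smul ε) hu
    refine ⟨fun q => ε • v q, hv.const_smul ε, fun q => ?_⟩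
    have h1 := hvq q
    rw [hev] at h1
    rw [← h1, fderiv_fun_const_smul (hv.differentiable (by simp) q)]
    simp
  · have h1 := hS.eq_curve (hX.const_smul ε) (γ := fun s => γ (ε * s)) h12 (fun s hs => by
      have h2 : 0 ≤ ε * s := mul_nonneg hε.le hs.1
      have h3 := (hγ (ε * s) h2).scomp s
        (((hasDerivAt_id s).const_mul ε).hasDerivWithinAt (s := Icc 0 1))
        (fun r hr => mul_nonneg hε.le hr.1)
      simpa [Function.comp_def] using h3)
    simp only [mul_zero] at h1
    rw [← h1]
    simp only [hev]

end Transport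

/-! ### A quadratic Lyapunov function for a linear source -/

section Lyapunov

/-- By Gelfand's formula ‖a^n‖ is eventually below r^n for any r between the spectral radius and 1.
-/
theorem tendsto_pow_zero_of_spectralRadius_lt_one {A : Type*} [NormedRing A] [NormedAlgebra ℂ A]
    [CompleteSpace A] {a : A} (h : spectralRadius ℂ a < 1) :
    Tendsto (fun n : ℕ => a ^ n) atTop (𝓝 0) := by
  obtain ⟨r, hr, hr1⟩ := ENNReal.lt_iff_exists_nnreal_btwn.1 h
  have hr1' : r < 1 := by exact_mod_cast hr1
  have h1 := (spectrum.pow_nnnorm_pow_one_div_tendsto_nhds_spectralRadius a).eventually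
    (gt_mem_nhds hr)
  refine squeeze_zero_norm' (a := fun n => (r : ℝ) ^ n) ?_
    (tendsto_pow_atTop_nhds_zero_of_lt_one r.2 hr1')
  filter_upwards [h1, eventually_gt_atTop 0] with n hn hn0
  have hn' : (0 : ℝ) < n := by exact_mod_cast hn0
  have h2 := ENNReal.rpow_le_rpow hn.le hn'.le
  rw [← ENNReal.rpow_mul, one_div_mul_cancel hn'.ne', ENNReal.rpow_one, ENNReal.rpow_natCast] at h2
  exact_mod_cast h2

/-- For w in the spectrum, |1 - hw|² = 1 - 2h Re w + h²|w|². The spectrum is compact, so a small h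
makes this less than 1 for all w at once, and 1 - ha has spectral radius below 1. -/
theorem exists_tendsto_one_sub_smul_pow {A : Type*} [NormedRing A] [NormedAlgebra ℂ A]
    [CompleteSpace A] {a : A} (ha : ∀ z ∈ spectrum ℂ a, 0 < z.re) :
    ∃ h : ℝ, 0 < h ∧ Tendsto (fun n : ℕ => (1 - (h : ℂ) • a) ^ n) atTop (𝓝 0) := by
  rcases subsingleton_or_nontrivial A with hA | hA
  · exact ⟨1, one_pos, tendsto_const_nhds.congr fun n => Subsingleton.elim _ _⟩
  have hc : IsCompact (spectrum ℂ a) := spectrum.isCompact a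
  obtain ⟨z₀, hz₀, hmin⟩ := hc.exists_isMinOn (spectrum.nonempty a) Complex.continuous_re.continuousOn
  obtain ⟨R, hR⟩ := hc.exists_bound_of_continuousOn continuousOn_id
  have hc0 := ha z₀ hz₀
  have hR0 : 0 ≤ R := (norm_nonneg _).trans (hR z₀ hz₀)
  -- With this h, h|w|² ≤ hR² < Re z₀ ≤ Re w for every w in the spectrum, which is more than needed.
  refine ⟨z₀.re / (R ^ 2 + 1), by positivity, ?_⟩
  set h := z₀.re / (R ^ 2 + 1) with hh
  have hpos : 0 < h := by positivity
  have hhR : h * (R ^ 2 + 1) = z₀.re := by rw [hh]; field_simp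
  refine tendsto_pow_zero_of_spectralRadius_lt_one
    (spectrum.spectralRadius_lt_of_forall_lt (r := 1) _ fun z hz => ?_)
  have hw : (1 - z) / h ∈ spectrum ℂ a := by
    have hne : (h : ℂ) ≠ 0 := by exact_mod_cast hpos.ne'
    rw [spectrum.mem_iff] at hz ⊢
    contrapose! hz
    have h1 := hz.smul (Units.mk0 (-(h : ℂ)) (neg_ne_zero.2 hne))
    convert h1 using 1
    rw [Units.smul_def, Units.val_mk0, smul_sub, Algebra.algebraMap_eq_smul_one,
      Algebra.algebraMap_eq_smul_one, smul_smul, neg_mul, mul_div_cancel₀ _ hne]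
    module
  have h1 := hmin hw
  have h2 := hR _ hw
  set w := (1 - z) / (h : ℂ) with hwdef
  have hz' : z = 1 - h * w := by
    have hne : (h : ℂ) ≠ 0 := by exact_mod_cast hpos.ne'
    rw [hwdef]; field_simp; ring
  have h3 : ‖w‖ ^ 2 ≤ R ^ 2 := pow_le_pow_left₀ (norm_nonneg _) h2 2
  rw [← NNReal.coe_lt_coe, coe_nnnorm, NNReal.coe_one, ← sq_lt_one_iff₀ (norm_nonneg _),
    Complex.sq_norm, hz']
  rw [Complex.sq_norm] at h3
  simp only [Complex.normSq_apply] at h3 ⊢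
  simp only [Complex.sub_re, Complex.one_re, Complex.mul_re, Complex.ofReal_re, Complex.ofReal_im,
    zero_mul, sub_zero, Complex.sub_im, Complex.one_im, Complex.mul_im, add_zero, zero_sub]
  have h4 : z₀.re ≤ w.re := h1
  have h5 : h * (w.re * w.re + w.im * w.im) < 2 * w.re := by
    have : h * (w.re * w.re + w.im * w.im) ≤ h * R ^ 2 := mul_le_mul_of_nonneg_left h3 hpos.le
    nlinarith
  nlinarith

variable {E : Type*} [NormedAddCommGroup E] [InnerProductSpace ℝ E] [FiniteDimensional ℝ E]

-- The powers converge to zero for the complexified matrix of M, whose spectrum consists of the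
-- eigenvalues. Taking real parts and going back from matrices to endomorphisms is continuous, so
-- the powers of 1 - hM converge to zero as well.
omit [InnerProductSpace ℝ E] [FiniteDimensional ℝ E] in
theorem exists_norm_one_sub_smul_pow_le [NormedSpace ℝ E] [FiniteDimensional ℝ E] (M : E →L[ℝ] E)
    (hM : ∀ z ∈ eigenvalues (M : E →ₗ[ℝ] E), 0 < z.re) :
    ∃ h : ℝ, 0 < h ∧ ∃ m : ℕ, 0 < m ∧ ‖((1 - h • M) ^ m : E →L[ℝ] E)‖ ≤ 1 / 2 := by
  classical
  let b := Module.finBasis ℝ E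
  let ι := Fin (Module.finrank ℝ E)
  let A : Matrix ι ι ℝ := LinearMap.toMatrixAlgEquiv b (M : E →ₗ[ℝ] E)
  let _ : NormedRing (Matrix ι ι ℂ) := Matrix.linftyOpNormedRing
  let _ : NormedAlgebra ℂ (Matrix ι ι ℂ) := Matrix.linftyOpNormedAlgebra
  let ψ : Matrix ι ι ℝ →ₐ[ℝ] Matrix ι ι ℂ := Complex.ofRealAm.mapMatrix
  have hspec : ∀ z ∈ spectrum ℂ (ψ A), 0 < z.re := fun z hz => by
    refine hM z ?_
    have h1 := Matrix.mem_spectrum_iff_isRoot_charpoly.1 hz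
    have h2 : (ψ A).charpoly = (M : E →ₗ[ℝ] E).charpoly.map (toComplex ℝ) := by
      rw [← LinearMap.charpoly_toMatrix (M : E →ₗ[ℝ] E) b]
      exact Matrix.charpoly_map A Complex.ofRealHom
    rw [h2] at h1
    exact (Polynomial.mem_roots ((LinearMap.charpoly_monic _).map _).ne_zero).2 h1
  obtain ⟨h, hh, hlim⟩ := exists_tendsto_one_sub_smul_pow hspec
  refine ⟨h, hh, ?_⟩
  let re : Matrix ι ι ℂ →ₗ[ℝ] Matrix ι ι ℝ := Complex.reLm.mapMatrix
  let Φ : Matrix ι ι ℂ →ₗ[ℝ] (E →L[ℝ] E) :=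
    (LinearMap.toContinuousLinearMap.toLinearMap ∘ₗ (Matrix.toLinAlgEquiv b).toLinearMap) ∘ₗ re
  have hΦ : Continuous Φ := LinearMap.continuous_of_finiteDimensional Φ
  have hΦn : ∀ n : ℕ, Φ ((1 - (h : ℂ) • ψ A) ^ n) = (1 - h • M) ^ n := fun n => by
    have h1 : (1 - (h : ℂ) • ψ A) ^ n = ψ ((1 - h • A) ^ n) := by
      rw [map_pow, map_sub, map_one, map_smul]
      rfl
    have h2 : ∀ C, re (ψ C) = C := fun C => by ext i j; simp [re, ψ]
    have h3 : Matrix.toLinAlgEquiv b ((1 - h • A) ^ n) = (1 - h • (M : E →ₗ[ℝ] E)) ^ n := by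
      rw [map_pow, map_sub, map_one, map_smul]
      simp only [A, Matrix.toLinAlgEquiv_toMatrixAlgEquiv]
    have h4 : ((((1 - h • M) ^ n : E →L[ℝ] E)) : E →ₗ[ℝ] E) = (1 - h • (M : E →ₗ[ℝ] E)) ^ n := by
      rw [ContinuousLinearMap.toLinearMap_pow]
      rfl
    rw [h1]
    simp only [Φ, LinearMap.comp_apply, h2]
    apply ContinuousLinearMap.coe_injective
    rw [h4, ← h3]
    rfl
  have hlim' := (hΦ.tendsto 0).comp hlim
  rw [map_zero] at hlim'
  have hev := (hlim'.eventually (Metric.closedBall_mem_nhds 0 (by norm_num : (0 : ℝ) < 1 / 2))).and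
    (eventually_gt_atTop 0)
  obtain ⟨m, hm, hm0⟩ := hev.exists
  refine ⟨m, hm0, ?_⟩
  rw [Function.comp_apply, hΦn] at hm
  simpa using hm

/-- A linear map all of whose eigenvalues have positive real part is strictly accretive with respect
to some scalar product. -/
theorem exists_bilin_accretive (M : E →L[ℝ] E)
    (hM : ∀ z ∈ eigenvalues (M : E →ₗ[ℝ] E), 0 < z.re) :
    ∃ b : E →L[ℝ] E →L[ℝ] ℝ, (∀ v w, b v w = b w v) ∧ (∀ v, ‖v‖ ^ 2 ≤ b v v) ∧
      ∃ c : ℝ, 0 < c ∧ ∀ v, c * ‖v‖ ^ 2 ≤ b v (M v) := by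
  obtain ⟨h, hh, m, hm, hC⟩ := exists_norm_one_sub_smul_pow_le M hM
  set C : E →L[ℝ] E := 1 - h • M with hCdef
  -- Summing the pullbacks of the scalar product under C^j for j < m makes b(Cv, Cv) - b(v, v)
  -- telescope to ‖C^m v‖² - ‖v‖².
  let b : E →L[ℝ] E →L[ℝ] ℝ :=
    ∑ j ∈ Finset.range m, (innerSL ℝ (E := E)).bilinearComp (C ^ j) (C ^ j)
  have hb : ∀ v w, b v w = ∑ j ∈ Finset.range m, inner ℝ ((C ^ j) v) ((C ^ j) w) := fun v w => by
    simp [b]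
  have hbs : ∀ v w, b v w = b w v := fun v w => by
    simp only [hb, real_inner_comm]
  have hbb : ∀ v, b v v = ∑ j ∈ Finset.range m, ‖(C ^ j) v‖ ^ 2 := fun v => by
    simp only [hb, real_inner_self_eq_norm_sq]
  have hnn : ∀ v, 0 ≤ b v v := fun v => by
    rw [hbb]; exact Finset.sum_nonneg fun _ _ => by positivity
  -- Expanding b(Cv, Cv) with C = 1 - hM and dropping h² b(Mv, Mv) ≥ 0 leaves 2h b(v, Mv) ≥ ‖v‖² -
  -- ‖C^m v‖² ≥ (3/4)‖v‖².
  refine ⟨b, hbs, fun v => ?_, 3 / (8 * h), by positivity, fun v => ?_⟩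
  · rw [hbb]
    have := Finset.single_le_sum (f := fun j => ‖(C ^ j) v‖ ^ 2) (fun _ _ => by positivity)
      (Finset.mem_range.2 hm)
    simpa using this
  · have h1 : b (C v) (C v) = b v v - ‖v‖ ^ 2 + ‖(C ^ m) v‖ ^ 2 := by
      rw [hbb, hbb]
      have h2 : ∀ j, (C ^ j) (C v) = (C ^ (j + 1)) v := fun j => by rw [pow_succ]; rfl
      simp only [h2]
      have h3 := Finset.sum_range_succ (fun j => ‖(C ^ j) v‖ ^ 2) m
      have h4 := Finset.sum_range_succ' (fun j => ‖(C ^ j) v‖ ^ 2) m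
      simp only [pow_zero, one_apply_eq_self] at h4
      linarith
    have h2 : b (C v) (C v) = b v v - 2 * h * b v (M v) + h ^ 2 * b (M v) (M v) := by
      have : C v = v - h • M v := rfl
      rw [this]
      simp only [map_sub, map_smul, _root_.sub_apply, _root_.smul_apply,
        smul_eq_mul, hbs (M v) v]
      ring
    have h3 : ‖(C ^ m) v‖ ≤ 1 / 2 * ‖v‖ := (C ^ m).le_of_opNorm_le hC v
    have h4 : ‖(C ^ m) v‖ ^ 2 ≤ 1 / 4 * ‖v‖ ^ 2 := by
      have := pow_le_pow_left₀ (norm_nonneg _) h3 2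
      linarith [this]
    have h5 := mul_nonneg (sq_nonneg h) (hnn (M v))
    rw [div_mul_eq_mul_div, div_le_iff₀ (by positivity)]
    nlinarith

end Lyapunov

/-! ### Attraction of compact sets by the source in backward time -/

section Attraction

variable {E : Type*} [NormedAddCommGroup E]

/-- `γ` is a solution of `γ' = -X(γ)` on `[0, ∞)`. -/
def IsBackwardCurve [NormedSpace ℝ E] (X : E → E) (γ : ℝ → E) : Prop :=
  ∀ s ≥ 0, HasDerivWithinAt γ (-X (γ s)) (Ici 0) s

theorem IsBackwardCurve.hasDerivWithinAt_Ici [NormedSpace ℝ E] {X : E → E} {γ : ℝ → E}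
    (h : IsBackwardCurve X γ) {s : ℝ} (hs : 0 ≤ s) : HasDerivWithinAt γ (-X (γ s)) (Ici s) s :=
  (h s hs).mono (Ici_subset_Ici.2 hs)

theorem IsBackwardCurve.continuousOn [NormedSpace ℝ E] {X : E → E} {γ : ℝ → E}
    (h : IsBackwardCurve X γ) : ContinuousOn γ (Ici 0) :=
  fun s hs => (h s hs).continuousWithinAt

theorem IsStarShaped.exists_backwardCurve [NormedSpace ℝ E] {U : Set E} {X : E → E} {p : E}
    (h : IsStarShaped U X p) {q : E} (hq : q ∈ U) :
    ∃ γ : ℝ → E, γ 0 = q ∧ IsBackwardCurve X γ ∧ (∀ s ≥ 0, γ s ∈ U) ∧ Tendsto γ atTop (𝓝 p) := by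
  obtain ⟨γ, h0, hγ, hγU, hlim⟩ := h q hq
  refine ⟨fun s => γ (-s), by simpa using h0, fun s hs => ?_, fun s hs => hγU _ (by linarith),
    hlim.comp tendsto_neg_atTop_atBot⟩
  have h1 := (hγ (-s) (show -s ≤ 0 by linarith)).scomp s
    ((hasDerivAt_neg s).hasDerivWithinAt (s := Ici 0)) (fun r hr => neg_nonpos.2 hr)
  simpa [Function.comp_def] using h1

section Lipschitz

variable [NormedSpace ℝ E] [FiniteDimensional ℝ E]

/-- One of the two points stays in C, so the mean value inequality is only needed on balls around
points of C. These are convex, unlike the thickening of C on which the derivative of X is bounded.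
-/
theorem exists_lipschitz_near_compact {U : Set E} (hU : IsOpen U) {X : E → E}
    (hX : ContDiffOn ℝ ∞ X U) {C : Set E} (hC : IsCompact C) (hCU : C ⊆ U) :
    ∃ ρ > 0, Metric.cthickening ρ C ⊆ U ∧ ∃ L ≥ (0 : ℝ),
      ∀ x ∈ C, ∀ y, ‖y - x‖ ≤ ρ → ‖X y - X x‖ ≤ L * ‖y - x‖ := by
  obtain ⟨ρ, hρ, hρU⟩ := hC.exists_cthickening_subset_open hU hCU
  have hcomp : IsCompact (Metric.cthickening ρ C) := hC.cthickening
  have hcont : ContinuousOn (fderiv ℝ X) U := hX.continuousOn_fderiv_of_isOpen hU (by simp)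
  obtain ⟨L, hL⟩ := hcomp.exists_bound_of_continuousOn (hcont.mono hρU)
  refine ⟨ρ, hρ, hρU, max L 0, le_max_right _ _, fun x hx y hy => ?_⟩
  have hball : Metric.closedBall x ρ ⊆ Metric.cthickening ρ C :=
    Metric.closedBall_subset_cthickening hx ρ
  refine (convex_closedBall x ρ).norm_image_sub_le_of_norm_fderiv_le (𝕜 := ℝ) (fun z hz => ?_)
    (fun z hz => (hL z (hball hz)).trans (le_max_left _ _)) (Metric.mem_closedBall_self hρ.le)
    (by rwa [mem_closedBall_iff_norm])
  exact (hX.contDiffAt (hU.mem_nhds (hρU (hball hz)))).differentiableAt (by simp)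

/-- Continuous dependence on the initial value, for the solutions of an autonomous equation on an
open set. -/
theorem IsBackwardCurve.exists_tube {U : Set E} (hU : IsOpen U) {X : E → E}
    (hX : ContDiffOn ℝ ∞ X U) {γ : ℝ → E} (hγ : IsBackwardCurve X γ) (hγU : ∀ s ≥ 0, γ s ∈ U)
    {t : ℝ} (ht : 0 ≤ t) {O : Set E} (hO : O ∈ 𝓝 (γ t)) :
    ∃ K : Set E, IsCompact K ∧ K ⊆ U ∧ ∃ W ∈ 𝓝 (γ 0), ∀ η : ℝ → E, IsBackwardCurve X η →
      η 0 ∈ W → (∀ s ∈ Icc 0 t, η s ∈ K) ∧ η t ∈ O := by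
  have hC : IsCompact (γ '' Icc 0 t) :=
    isCompact_Icc.image_of_continuousOn (hγ.continuousOn.mono Icc_subset_Ici_self)
  have hCU : γ '' Icc 0 t ⊆ U := by
    rintro _ ⟨s, hs, rfl⟩
    exact hγU s hs.1
  obtain ⟨ρ, hρ, hρU, L, hL, hLip⟩ := exists_lipschitz_near_compact hU hX hC hCU
  obtain ⟨ρ', hρ', hρO⟩ := Metric.nhds_basis_closedBall.mem_iff.1 hO
  set r := min ρ ρ' with hr
  have hr0 : 0 < r := lt_min hρ hρ'
  -- The distance of the two curves is compared with δ e^((L+1)s), which stays at most r on [0, t].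
  -- The exponent L + 1 instead of L makes the differential inequality strict where the two touch.
  set δ := r * Real.exp (-((L + 1) * t)) with hδ
  have hδ0 : 0 < δ := by positivity
  refine ⟨Metric.cthickening ρ (γ '' Icc 0 t), hC.cthickening, hρU, Metric.closedBall (γ 0) δ,
    Metric.closedBall_mem_nhds _ hδ0, fun η hη h0 => ?_⟩
  have hB : ∀ s ∈ Icc 0 t, δ * Real.exp ((L + 1) * s) ≤ r := fun s hs => by
    rw [hδ, mul_assoc, ← Real.exp_add]
    refine mul_le_of_le_one_right hr0.le (Real.exp_le_one_iff.2 ?_)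
    have : (L + 1) * s ≤ (L + 1) * t := mul_le_mul_of_nonneg_left hs.2 (by linarith)
    linarith
  have hd : ∀ s, HasDerivAt (fun s => δ * Real.exp ((L + 1) * s))
      ((L + 1) * (δ * Real.exp ((L + 1) * s))) s := fun s => by
    have := (((hasDerivAt_id s).const_mul (L + 1)).exp).const_mul δ
    refine this.congr_deriv ?_
    simp only [id_eq]
    ring
  have key : ∀ s ∈ Icc 0 t, ‖η s - γ s‖ ≤ δ * Real.exp ((L + 1) * s) := by
    intro s hs
    refine image_norm_le_of_norm_deriv_right_lt_deriv_boundary'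
      (f := fun s => η s - γ s) (f' := fun s => -X (η s) - -X (γ s))
      (B := fun s => δ * Real.exp ((L + 1) * s)) (a := 0) (b := t)
      ((hη.continuousOn.sub hγ.continuousOn).mono Icc_subset_Ici_self)
      (fun x hx => (hη.hasDerivWithinAt_Ici hx.1).sub (hγ.hasDerivWithinAt_Ici hx.1))
      ?_ (fun x _ => (hd x).continuousAt.continuousWithinAt)
      (fun x _ => (hd x).hasDerivWithinAt) (fun x hx h => ?_) hs
    · simpa [dist_eq_norm] using h0
    · have hx' := Ico_subset_Icc_self hx
      have h1 : ‖η x - γ x‖ ≤ ρ := h.le.trans ((hB x hx').trans (min_le_left _ _))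
      have h2 := hLip (γ x) (mem_image_of_mem _ hx') (η x) h1
      have h3 : -X (η x) - -X (γ x) = -(X (η x) - X (γ x)) := by abel
      rw [h3, norm_neg]
      have h4 : ‖η x - γ x‖ = δ * Real.exp ((L + 1) * x) := h
      rw [h4] at h2
      have h5 : 0 < δ * Real.exp ((L + 1) * x) := by positivity
      linarith
  refine ⟨fun s hs => Metric.closedBall_subset_cthickening (mem_image_of_mem _ hs) ρ ?_,
    hρO ?_⟩
  · rw [mem_closedBall_iff_norm]
    exact (key s hs).trans ((hB s hs).trans (min_le_left _ _))
  · have ht' : t ∈ Icc 0 t := ⟨ht, le_rfl⟩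
    rw [mem_closedBall_iff_norm]
    exact (key t ht').trans ((hB t ht').trans (min_le_right _ _))

end Lipschitz

variable [InnerProductSpace ℝ E] [FiniteDimensional ℝ E]

/-- The form b that is accretive for DX(p) remains so for X near p, because the remainder X(x) -
DX(p)(x - p) is o(‖x - p‖) and uses up at most half of the constant. -/
theorem IsStrictlyPositiveSource.exists_lyapunov {U : Set E} (hU : IsOpen U) {X : E → E} {p : E}
    (hpU : p ∈ U) (hX : ContDiffOn ℝ ∞ X U) (hp : IsStrictlyPositiveSource X p) :
    ∃ b : E →L[ℝ] E →L[ℝ] ℝ, (∀ v w, b v w = b w v) ∧ (∀ v, ‖v‖ ^ 2 ≤ b v v) ∧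
      ∃ r > 0, ∃ c > 0, ∀ x, b (x - p) (x - p) ≤ r →
        x ∈ U ∧ c * b (x - p) (x - p) ≤ b (x - p) (X x) := by
  obtain ⟨b, hbs, hbn, c, hc, hbc⟩ := exists_bilin_accretive (fderiv ℝ X p) hp.re_pos
  refine ⟨b, hbs, hbn, ?_⟩
  set β := ‖b‖ + 1 with hβ
  have hβ0 : 0 < β := by positivity
  have hbβ : ∀ v w, |b v w| ≤ β * ‖v‖ * ‖w‖ := fun v w => by
    refine (b.le_opNorm₂ v w).trans ?_
    gcongr
    linarith
  have hd : HasFDerivAt X (fderiv ℝ X p) p :=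
    ((hX.contDiffAt (hU.mem_nhds hpU)).differentiableAt (by simp)).hasFDerivAt
  have h1 := (hasFDerivAt_iff_isLittleO.1 hd).def (c := c / (2 * β)) (by positivity)
  obtain ⟨ρ, hρ, hball⟩ := Metric.eventually_nhds_iff_ball.1 (h1.and (hU.mem_nhds hpU))
  -- Since ‖v‖² ≤ b(v, v), the level ρ²/2 forces ‖x - p‖ < ρ. The rate c/(2β) translates (c/2)‖v‖²
  -- into a multiple of b(v, v) ≤ β‖v‖².
  refine ⟨ρ ^ 2 / 2, by positivity, c / (2 * β), by positivity, fun x hx => ?_⟩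
  have h2 : x ∈ Metric.ball p ρ := by
    rw [mem_ball_iff_norm]
    refine lt_of_pow_lt_pow_left₀ 2 hρ.le ?_
    have := hbn (x - p)
    have : 0 < ρ ^ 2 := by positivity
    linarith
  obtain ⟨h3, h4⟩ := hball x h2
  refine ⟨h4, ?_⟩
  rw [hp.apply_eq_zero, sub_zero] at h3
  set v := x - p with hv
  have h5 : b v (X x) = b v (fderiv ℝ X p v) + b v (X x - fderiv ℝ X p v) := by
    rw [← map_add, add_sub_cancel]
  have h6 := hbβ v (X x - fderiv ℝ X p v)
  have h7 : β * ‖v‖ * ‖X x - fderiv ℝ X p v‖ ≤ c / 2 * ‖v‖ ^ 2 := by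
    calc β * ‖v‖ * ‖X x - fderiv ℝ X p v‖ ≤ β * ‖v‖ * (c / (2 * β) * ‖v‖) := by gcongr
      _ = c / 2 * ‖v‖ ^ 2 := by field_simp
  have h8 := (abs_le.1 (h6.trans h7)).1
  have h9 := hbc v
  have h10 : c / (2 * β) * b v v ≤ c / 2 * ‖v‖ ^ 2 := by
    have h11 := (le_abs_self _).trans (hbβ v v)
    calc c / (2 * β) * b v v ≤ c / (2 * β) * (β * ‖v‖ * ‖v‖) := by gcongr
      _ = c / 2 * ‖v‖ ^ 2 := by field_simp
  linarith

-- Along the curve, b(γ - p, γ - p) has derivative at most -2c times itself in the sublevel set.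
-- Comparing with the decay rate c only leaves a strict inequality at contact points; these lie in
-- the sublevel set, as the comparison function never exceeds r.
omit [FiniteDimensional ℝ E] in
theorem IsBackwardCurve.bilin_le {X : E → E} {p : E} {b : E →L[ℝ] E →L[ℝ] ℝ}
    (hbs : ∀ v w, b v w = b w v) {r c : ℝ} (hr : 0 < r) (hc : 0 < c)
    (hb : ∀ x, b (x - p) (x - p) ≤ r → c * b (x - p) (x - p) ≤ b (x - p) (X x))
    {γ : ℝ → E} (hγ : IsBackwardCurve X γ) {a s : ℝ} (ha : 0 ≤ a) (has : a ≤ s)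
    (h0 : b (γ a - p) (γ a - p) ≤ r) :
    b (γ s - p) (γ s - p) ≤ r * Real.exp (-(c * (s - a))) := by
  have hd : ∀ s, HasDerivAt (fun s => r * Real.exp (-(c * (s - a))))
      (-(c * (r * Real.exp (-(c * (s - a)))))) s := fun s => by
    have := (((((hasDerivAt_id s).sub_const a).const_mul c).neg).exp).const_mul r
    refine this.congr_deriv ?_
    simp only [id_eq, Pi.neg_apply]
    ring
  have hder : ∀ x ∈ Ico a s, HasDerivWithinAt (fun s => b (γ s - p) (γ s - p))
      (-(2 * b (γ x - p) (X (γ x)))) (Ici x) x := fun x hx => by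
    have h1 := (hγ.hasDerivWithinAt_Ici (ha.trans hx.1)).sub_const p
    have h2 := (b.hasFDerivAt.comp_hasDerivWithinAt x h1).clm_apply h1
    have h3 : -(2 * b (γ x - p) (X (γ x))) =
        b (-X (γ x)) (γ x - p) + b (γ x - p) (-X (γ x)) := by
      rw [hbs (-X (γ x)), map_neg]
      ring
    rw [h3]
    exact h2
  have hcont : ContinuousOn (fun s => b (γ s - p) (γ s - p)) (Icc a s) := by
    have h1 : ContinuousOn (fun s => γ s - p) (Icc a s) :=
      (hγ.continuousOn.mono (Icc_subset_Ici_self.trans (Ici_subset_Ici.2 ha))).sub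
        continuousOn_const
    exact (b.continuous.comp_continuousOn h1).clm_apply h1
  refine image_le_of_deriv_right_lt_deriv_boundary' hcont hder
    (B := fun s => r * Real.exp (-(c * (s - a)))) (by simpa using h0)
    (fun x _ => (hd x).continuousAt.continuousWithinAt) (fun x _ => (hd x).hasDerivWithinAt)
    (fun x hx h => ?_) ⟨has, le_rfl⟩
  have hpos : 0 < r * Real.exp (-(c * (x - a))) := by positivity
  have hle : r * Real.exp (-(c * (x - a))) ≤ r := by
    refine mul_le_of_le_one_right hr.le (Real.exp_le_one_iff.2 ?_)
    have := mul_nonneg hc.le (sub_nonneg.2 hx.1)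
    linarith
  have h1 := hb (γ x) (h.le.trans hle)
  rw [show b (γ x - p) (γ x - p) = _ from h] at h1
  have h2 : 0 < c * (r * Real.exp (-(c * (x - a)))) := by positivity
  linarith

/-- A compact set in a star-shaped neighborhood of a source is attracted uniformly in backward time
by the source, inside of a compact set. -/
theorem exists_compact_hull {U : Set E} (hU : IsOpen U) {X : E → E} {p : E}
    (hpU : p ∈ U) (hX : ContDiffOn ℝ ∞ X U) (hp : IsStrictlyPositiveSource X p)
    (hS : IsStarShaped U X p) {K : Set E} (hK : IsCompact K) (hKU : K ⊆ U) :
    ∃ K' : Set E, IsCompact K' ∧ K' ⊆ U ∧ K ⊆ K' ∧ ∃ γ : E → ℝ → E,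
      (∀ q ∈ K, γ q 0 = q ∧ IsBackwardCurve X (γ q) ∧ ∀ s ≥ 0, γ q s ∈ K') ∧
      ∀ W ∈ 𝓝 p, ∃ t ≥ 0, ∀ q ∈ K, ∀ s ≥ t, γ q s ∈ W := by
  obtain ⟨b, hbs, hbn, r, hr, c, hc, hb⟩ := hp.exists_lyapunov hU hpU hX
  set f : E → ℝ := fun x => b (x - p) (x - p) with hf
  have hfc : Continuous f := by fun_prop
  have hfp : f p = 0 := by simp [hf]
  have hγ : ∀ q ∈ U, ∃ γ : ℝ → E, γ 0 = q ∧ IsBackwardCurve X γ ∧ (∀ s ≥ 0, γ s ∈ U) ∧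
    Tendsto γ atTop (𝓝 p) := fun q hq => hS.exists_backwardCurve hq
  choose! γ hγ0 hγc hγU hγlim using hγ
  -- The curve from q enters the sublevel set f ≤ r at some time t. By continuous dependence so do
  -- the curves from nearby points at the same time, staying in one compact set C until then.
  have hloc : ∀ q ∈ U, ∃ t ≥ (0 : ℝ), ∃ C : Set E, IsCompact C ∧ C ⊆ U ∧ ∃ W ∈ 𝓝 q,
      ∀ q' ∈ U ∩ W, (∀ s ∈ Icc 0 t, γ q' s ∈ C) ∧ f (γ q' t) ≤ r := fun q hq => by
    have h1 : ∀ᶠ t in atTop, f (γ q t) < r :=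
      ((hfc.tendsto p).comp (hγlim q hq)).eventually (gt_mem_nhds (by rw [hfp]; exact hr))
    obtain ⟨t, ht, ht0⟩ := (h1.and (eventually_ge_atTop 0)).exists
    have hO : {x | f x ≤ r} ∈ 𝓝 (γ q t) :=
      mem_of_superset ((isOpen_lt hfc continuous_const).mem_nhds ht) fun x hx => show f x ≤ r from le_of_lt hx
    obtain ⟨C, hC, hCU, W, hW, hCW⟩ := (hγc q hq).exists_tube hU hX (hγU q hq) ht0 hO
    rw [hγ0 q hq] at hW
    refine ⟨t, ht0, C, hC, hCU, W, hW, fun q' hq' => hCW _ (hγc q' hq'.1) ?_⟩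
    rw [hγ0 q' hq'.1]
    exact hq'.2
  choose! t ht0 C hC hCU W hW hCW using hloc
  obtain ⟨I, hIK, hI⟩ := hK.elim_nhds_subcover W fun q hq => hW q (hKU hq)
  have hD : IsCompact {x | f x ≤ r} := by
    refine (isCompact_closedBall p (Real.sqrt r)).of_isClosed_subset
      (isClosed_le hfc continuous_const) fun x hx => ?_
    rw [mem_closedBall_iff_norm]
    exact Real.le_sqrt_of_sq_le ((hbn _).trans hx)
  have hidx : ∀ q ∈ K, ∃ i ∈ I, q ∈ W i := fun q hq => by
    simpa using hI hq
  have hdecay : ∀ q ∈ K, ∀ i ∈ I, q ∈ W i → ∀ s, t i ≤ s →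
      f (γ q s) ≤ r * Real.exp (-(c * (s - t i))) := fun q hq i hi hqi s hs =>
    (hγc q (hKU hq)).bilin_le hbs hr hc (fun x hx => (hb x hx).2)
      (ht0 i (hKU (hIK i hi))) hs (hCW i (hKU (hIK i hi)) q ⟨hKU hq, hqi⟩).2
  have hmem : ∀ q ∈ K, ∀ s ≥ 0, γ q s ∈ (⋃ i ∈ I, C i) ∪ {x | f x ≤ r} := by
    intro q hq s hs
    obtain ⟨i, hi, hqi⟩ := hidx q hq
    rcases le_total s (t i) with h | h
    · exact Or.inl (mem_biUnion hi ((hCW i (hKU (hIK i hi)) q ⟨hKU hq, hqi⟩).1 s ⟨hs, h⟩))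
    · refine Or.inr ((hdecay q hq i hi hqi s h).trans ?_)
      refine mul_le_of_le_one_right hr.le (Real.exp_le_one_iff.2 ?_)
      have := mul_nonneg hc.le (sub_nonneg.2 h)
      linarith
  -- The finitely many tubes contain the curves until they enter the sublevel set, which they never
  -- leave afterwards.
  refine ⟨(⋃ i ∈ I, C i) ∪ {x | f x ≤ r},
    (I.isCompact_biUnion fun i hi => hC i (hKU (hIK i hi))).union hD,
    union_subset (iUnion₂_subset fun i hi => hCU i (hKU (hIK i hi))) fun x hx => (hb x hx).1,
    fun q hq => ?_, γ, fun q hq => ⟨hγ0 q (hKU hq), hγc q (hKU hq), hmem q hq⟩, fun O hO => ?_⟩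
  · have := hmem q hq 0 le_rfl
    rwa [hγ0 q (hKU hq)] at this
  · obtain ⟨ε, hε, hεO⟩ := Metric.nhds_basis_ball.mem_iff.1 hO
    set τ := ∑ i ∈ I, t i with hτ
    have hτ0 : 0 ≤ τ := Finset.sum_nonneg fun i hi => ht0 i (hKU (hIK i hi))
    have hlim : Tendsto (fun s : ℝ => r * Real.exp (-(c * s))) atTop (𝓝 0) := by
      have := (Real.tendsto_exp_neg_atTop_nhds_zero.comp
        (tendsto_id.const_mul_atTop hc)).const_mul r
      simpa [Function.comp_def] using this
    obtain ⟨s₀, hs₀⟩ := eventually_atTop.1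
      (hlim.eventually (gt_mem_nhds (show (0 : ℝ) < ε ^ 2 by positivity)))
    -- τ, the sum of the finitely many entrance times, bounds each of them; s₀ is the time that the
    -- exponential decay then needs to get below ε².
    refine ⟨max s₀ 0 + τ, by positivity, fun q hq s hs => hεO ?_⟩
    obtain ⟨i, hi, hqi⟩ := hidx q hq
    have hti : t i ≤ τ :=
      Finset.single_le_sum (f := t) (fun i hi => ht0 i (hKU (hIK i hi))) hi
    have h0 : (0 : ℝ) ≤ max s₀ 0 := le_max_right _ _
    have h1 := hdecay q hq i hi hqi s (by linarith)
    have h2 := hs₀ (s - t i) (by linarith [le_max_left s₀ 0])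
    rw [mem_ball_iff_norm]
    exact lt_of_pow_lt_pow_left₀ 2 hε.le ((hbn _).trans_lt (h1.trans_lt h2))

end Attraction

/-! ### Cutoff functions and supports of distributions -/

section Cutoff

variable {E : Type*} [NormedAddCommGroup E] [NormedSpace ℝ E]

theorem exists_cutoff [FiniteDimensional ℝ E] {K U : Set E} (hK : IsCompact K) (hU : IsOpen U)
    (hKU : K ⊆ U) : ∃ χ : E → ℝ, ContDiff ℝ ∞ χ ∧ HasCompactSupport χ ∧ tsupport χ ⊆ U ∧
      ∀ᶠ x in 𝓝ˢ K, χ x = 1 := by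
  obtain ⟨δ, hδ, hδU⟩ := hK.exists_cthickening_subset_open hU hKU
  obtain ⟨χ, hχ, -, hsupp, hone⟩ := exists_contMDiff_support_eq_eq_one_iff
    (modelWithCornersSelf ℝ E) (n := ⊤) (Metric.isOpen_thickening (δ := δ) (E := K))
    (Metric.isClosed_cthickening (δ := δ / 2) (E := K))
    (Metric.cthickening_subset_thickening' hδ (by linarith) K)
  have ht : tsupport χ ⊆ Metric.cthickening δ K := by
    rw [tsupport, hsupp]
    exact Metric.closure_thickening_subset_cthickening δ K
  refine ⟨χ, hχ.contDiff, hK.cthickening.of_isClosed_subset (isClosed_tsupport χ) ht,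
    ht.trans hδU, ?_⟩
  refine mem_of_superset ((Metric.isOpen_thickening.mem_nhdsSet).2
    (Metric.self_subset_thickening (half_pos hδ) K)) fun x hx => ?_
  exact (hone x).1 (Metric.thickening_subset_cthickening _ _ hx)

theorem contDiff_smul_of_tsupport_subset {W : Type*} [NormedAddCommGroup W] [NormedSpace ℝ W]
    {U : Set E} (hU : IsOpen U) {χ : E → ℝ} (hχ : ContDiff ℝ ∞ χ) (hχU : tsupport χ ⊆ U)
    {f : E → W} (hf : ContDiffOn ℝ ∞ f U) : ContDiff ℝ ∞ (fun x => χ x • f x) := by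
  refine contDiff_iff_contDiffAt.2 fun x => ?_
  by_cases hx : x ∈ U
  · exact hχ.contDiffAt.smul (hf.contDiffAt (hU.mem_nhds hx))
  · have h1 : χ =ᶠ[𝓝 x] 0 := notMem_tsupport_iff_eventuallyEq.1 fun h => hx (hχU h)
    refine (contDiffAt_const (c := (0 : W))).congr_of_eventuallyEq ?_
    filter_upwards [h1] with y hy
    simp [hy]

theorem iteratedFDeriv_eq_zero_of_eventuallyEq {W : Type*} [NormedAddCommGroup W] [NormedSpace ℝ W]
    {f : E → W} {x : E} (h : f =ᶠ[𝓝 x] 0) (k : ℕ) : iteratedFDeriv ℝ k f x = 0 := by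
  rw [(h.iteratedFDeriv ℝ k).eq_of_nhds, iteratedFDeriv_zero]
  rfl

end Cutoff

/-! ### Bounds for compactly supported distributions and localization near their carriers -/

section Distribution

variable {𝕜 : Type*} [RCLike 𝕜] {E : Type*} [NormedAddCommGroup E] [NormedSpace ℝ E] {U : Opens E}
  {V : Type*} [NormedAddCommGroup V] [NormedSpace ℝ V] [NormedSpace 𝕜 V] [IsScalarTower ℝ 𝕜 V]

variable (𝕜) in
/-- The element of `C^∞(U, V)` given by a function that is smooth on `U`. -/
noncomputable def ofContDiffOn {u : E → V} (hu : ContDiffOn ℝ ∞ u U) : SmoothFun 𝕜 U V :=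
  ⟨(U : Set E).indicator u, hu.congr fun _ hx => indicator_of_mem hx u,
    fun _ hx => indicator_of_notMem hx u⟩

theorem ofContDiffOn_apply {u : E → V} (hu : ContDiffOn ℝ ∞ u U) {x : E} (hx : x ∈ U) :
    ofContDiffOn 𝕜 hu x = u x := indicator_of_mem (s := (U : Set E)) hx u

theorem ofContDiffOn_eventuallyEq {u : E → V} (hu : ContDiffOn ℝ ∞ u U) {x : E} (hx : x ∈ U) :
    ⇑(ofContDiffOn 𝕜 hu) =ᶠ[𝓝 x] u :=
  eventuallyEq_of_mem (U.isOpen.mem_nhds hx) fun _ hy => ofContDiffOn_apply hu hy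

theorem SmoothFun.coe_sub (u v : SmoothFun 𝕜 U V) : ⇑(u - v) = ⇑u - ⇑v := rfl

/-- `T` is bounded by the derivatives of order at most `M` on the compact set `K`. -/
def IsBoundedOn (T : CompactDistribution 𝕜 U V) (K : Set E) (M : ℕ) (C : ℝ) : Prop :=
  ∀ (u : SmoothFun 𝕜 U V) (D : ℝ), 0 ≤ D →
    (∀ k ≤ M, ∀ x ∈ K, ‖iteratedFDeriv ℝ k u x‖ ≤ D) → ‖T u‖ ≤ C * D

/-- Continuity bounds T by finitely many seminorms; the union of their compact sets and the maximum
of their orders serve for all of them. -/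
theorem exists_isBoundedOn (T : CompactDistribution 𝕜 U V) :
    ∃ K : Set E, IsCompact K ∧ K ⊆ U ∧ ∃ (M : ℕ) (C : ℝ), 0 ≤ C ∧ IsBoundedOn T K M C := by
  obtain ⟨s, C, -, hC⟩ := Seminorm.bound_of_continuous (withSeminorms (𝕜 := 𝕜) (U := U) (V := V))
    ((normSeminorm 𝕜 𝕜).comp (T : SmoothFun 𝕜 U V →ₗ[𝕜] 𝕜)) (T.continuous.norm)
  refine ⟨⋃ i ∈ s, (i.1.1 : Set E), s.isCompact_biUnion fun i _ => i.1.1.isCompact,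
    iUnion₂_subset fun i _ => i.1.2, s.sup Prod.snd, C, C.2, fun u D hD h => ?_⟩
  refine (hC u).trans ?_
  change (C : ℝ) * (s.sup (seminormFamily 𝕜 U V)) u ≤ C * D
  refine mul_le_mul_of_nonneg_left (Seminorm.finset_sup_apply_le hD fun i hi => ?_) C.2
  exact derivSeminorm_le _ _ _ hD fun x hx =>
    h i.2 (Finset.le_sup (f := Prod.snd) hi) x (mem_biUnion (x := i) hi hx)

theorem IsBoundedOn.apply_eq_zero {T : CompactDistribution 𝕜 U V} {K : Set E} {M : ℕ} {C : ℝ}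
    (h : IsBoundedOn T K M C) {u : SmoothFun 𝕜 U V} (hu : ∀ x ∈ K, ⇑u =ᶠ[𝓝 x] 0) : T u = 0 := by
  have h1 := h u 0 le_rfl fun k _ x hx => by
    rw [iteratedFDeriv_eq_zero_of_eventuallyEq (hu x hx), norm_zero]
  rw [mul_zero] at h1
  exact norm_le_zero_iff.1 h1

theorem IsBoundedOn.apply_eq {T : CompactDistribution 𝕜 U V} {K : Set E} {M : ℕ} {C : ℝ}
    (h : IsBoundedOn T K M C) {u v : SmoothFun 𝕜 U V} (huv : ∀ x ∈ K, ⇑u =ᶠ[𝓝 x] v) :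
    T u = T v := by
  rw [← sub_eq_zero, ← map_sub]
  refine h.apply_eq_zero fun x hx => ?_
  filter_upwards [huv x hx] with y hy
  simp [SmoothFun.coe_sub, hy]

end Distribution

/-! ### Localization of eigendistributions at the source -/

section Support

universe u

theorem iterate_transport_eq_zero {E V : Type*} [NormedAddCommGroup V] [NormedSpace ℝ V]
    {φ : E → E} {ρ : E → V →L[ℝ] V} {w : E → V} {O : Set E}
    (hw : ∀ x ∈ O, w x = 0) (m : ℕ) : ∀ q, φ^[m] q ∈ O →
      (fun (w : E → V) q => ρ q (w (φ q)))^[m] w q = 0 := by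
  induction m with
  | zero => exact fun q hq => hw q hq
  | succ m ih =>
    intro q hq
    rw [Function.iterate_succ_apply']
    rw [Function.iterate_succ_apply] at hq
    rw [ih _ hq, map_zero]

variable {𝕜 : Type*} [RCLike 𝕜] {E : Type} [NormedAddCommGroup E] [InnerProductSpace ℝ E]
  [FiniteDimensional ℝ E] {U : Opens E}
  {V : Type u} [NormedAddCommGroup V] [NormedSpace ℝ V] [NormedSpace 𝕜 V] [IsScalarTower ℝ 𝕜 V]
  [FiniteDimensional 𝕜 V]
  {X : E → E} {Γ : E → E →L[ℝ] V →L[𝕜] V} {A : E → V →L[𝕜] V}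

/-- A distribution in the kernel of the dual of `∇_X + A - λ` is supported in the source. -/
theorem apply_eq_zero_of_eventuallyEq_zero (hX : ContDiffOn ℝ ∞ X U) (hΓ : ContDiffOn ℝ ∞ Γ U)
    (hA : ContDiffOn ℝ ∞ A U) {p : U} (hp : IsStrictlyPositiveSource X p)
    (hU : IsStarShaped (U : Set E) X p) {lam : 𝕜} {T : CompactDistribution 𝕜 U V}
    (hT : ∀ u, T (operator hX hΓ hA u) = lam * T u) {u : SmoothFun 𝕜 U V}
    (hu : ⇑u =ᶠ[𝓝 (p : E)] 0) : T u = 0 := by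
  have : FiniteDimensional ℝ V := FiniteDimensional.trans ℝ 𝕜 V
  obtain ⟨K, hK, hKU, M, C, -, hTK⟩ := exists_isBoundedOn T
  obtain ⟨K', hK', hK'U, hKK', γ, hγ, hγp⟩ :=
    exists_compact_hull U.isOpen p.2 hX hp hU hK hKU
  -- K' contains the backward orbits of K. A cutoff that is 1 near K' makes the fields global and
  -- compactly supported without changing these orbits.
  obtain ⟨χ, hχ, hχc, hχU, hχ1⟩ := exists_cutoff hK' U.isOpen hK'U
  have hχK : ∀ x ∈ K', ∀ᶠ y in 𝓝 x, χ y = 1 := fun x hx => eventually_nhdsSet_iff_forall.1 hχ1 x hx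
  let B : E → V →L[ℝ] V := fun y => zerothOrder X Γ A y -
    ContinuousLinearMap.restrictScalars ℝ (lam • ContinuousLinearMap.id 𝕜 V)
  have hB : ContDiffOn ℝ ∞ B U := (contDiffOn_zerothOrder hX hΓ hA).sub contDiffOn_const
  obtain ⟨δ, hδ, φ, ρ, hφ, hρ, hsol, hcurve⟩ := exists_transport
    (contDiff_smul_of_tsupport_subset U.isOpen hχ hχU hX) hχc.smul_right
    (contDiff_smul_of_tsupport_subset U.isOpen hχ hχU hB) hχc.smul_right
  let R : (E → V) → E → V := fun w q => ρ q (w (φ q))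
  have hR : ∀ {w}, ContDiff ℝ ∞ w → ContDiff ℝ ∞ (R w) := fun hw =>
    hρ.clm_apply (hw.comp hφ)
  -- Near K the difference w - Rw is (∇_X + A - λ)v for some smooth v, and T kills the range of ∇_X
  -- + A - λ.
  have hTR : ∀ {w} (hw : ContDiff ℝ ∞ w), T (ofContDiffOn 𝕜 (U := U) hw.contDiffOn) =
      T (ofContDiffOn 𝕜 (U := U) (hR hw).contDiffOn) := fun {w} hw => by
    obtain ⟨v, hv, hvq⟩ := hsol w hw
    have h1 := hT (ofContDiffOn 𝕜 (U := U) hv.contDiffOn)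
    rw [← sub_eq_zero, ← smul_eq_mul, ← map_smul, ← map_sub] at h1
    rw [← sub_eq_zero, ← map_sub, ← h1]
    refine hTK.apply_eq fun x hx => ?_
    filter_upwards [hχK x (hKK' hx), U.isOpen.mem_nhds (hKU hx)] with y hy hyU
    have h2 := hvq y
    rw [hy, one_smul, one_smul] at h2
    have h3 : fderiv ℝ (ofContDiffOn 𝕜 (U := U) hv.contDiffOn) y = fderiv ℝ v y :=
      (ofContDiffOn_eventuallyEq _ hyU).fderiv_eq
    have h4 : operator hX hΓ hA (ofContDiffOn 𝕜 (U := U) hv.contDiffOn) y =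
        operatorFun U X Γ A (ofContDiffOn 𝕜 (U := U) hv.contDiffOn) y := rfl
    rw [SmoothFun.coe_sub, SmoothFun.coe_sub, SmoothFun.coe_smul, Pi.sub_apply, Pi.sub_apply,
      Pi.smul_apply, h4, operatorFun_eqOn _ hyU, Pi.add_apply, h3, ofContDiffOn_apply _ hyU,
      ofContDiffOn_apply _ hyU, ofContDiffOn_apply _ hyU]
    change w y - ρ y (w (φ y)) = _
    rw [← h2]
    simp [B, add_sub_assoc]
  have hRm : ∀ {w}, ContDiff ℝ ∞ w → ∀ m : ℕ, ContDiff ℝ ∞ (R^[m] w) := fun {w} hw m => by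
    induction m with
    | zero => exact hw
    | succ m ih =>
      rw [Function.iterate_succ_apply']
      exact hR ih
  have hTRm : ∀ {w} (hw : ContDiff ℝ ∞ w) (m : ℕ), T (ofContDiffOn 𝕜 (U := U) hw.contDiffOn) =
      T (ofContDiffOn 𝕜 (U := U) (hRm hw m).contDiffOn) := fun {w} hw m => by
    induction m with
    | zero => rfl
    | succ m ih =>
      rw [ih, hTR (hRm hw m)]
      simp only [Function.iterate_succ_apply']
  have hφγ : ∀ q ∈ K, ∀ s ≥ 0, φ (γ q s) = γ q (s + δ) := fun q hq s hs => by
    have h1 := hcurve (fun t => γ q (s + t)) fun t ht => by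
      have h2 := (hγ q hq).2.2 (s + t) (add_nonneg hs ht)
      rw [(hχK _ h2).self_of_nhds, one_smul]
      have h3 := ((hγ q hq).2.1 (s + t) (add_nonneg hs ht)).scomp t
        (((hasDerivAt_id t).const_add s).hasDerivWithinAt (s := Ici 0))
        (fun r hr => add_nonneg hs hr)
      simpa [Function.comp_def] using h3
    simpa using h1
  have hφm : ∀ q ∈ K, ∀ m : ℕ, φ^[m] q = γ q (m * δ) := fun q hq m => by
    induction m with
    | zero => simp [(hγ q hq).1]
    | succ m ih =>
      rw [Function.iterate_succ_apply', ih, hφγ q hq _ (by positivity)]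
      congr 1
      push_cast
      ring
  have hw : ContDiff ℝ ∞ (fun x => χ x • u x) :=
    contDiff_smul_of_tsupport_subset U.isOpen hχ hχU u.contDiffOn
  obtain ⟨O, hOu, hO, hpO⟩ := eventually_nhds_iff.1 hu
  obtain ⟨t, ht, htO⟩ := hγp O (hO.mem_nhds hpO)
  obtain ⟨m, hm⟩ := exists_nat_ge (t / δ)
  have hm' : t ≤ m * δ := (div_le_iff₀ hδ).1 hm
  have h1 : T u = T (ofContDiffOn 𝕜 (U := U) hw.contDiffOn) := by
    refine hTK.apply_eq fun x hx => ?_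
    filter_upwards [hχK x (hKK' hx), U.isOpen.mem_nhds (hKU hx)] with y hy hyU
    rw [ofContDiffOn_apply _ hyU, hy, one_smul]
  rw [h1, hTRm hw m]
  refine hTK.apply_eq_zero fun x hx => ?_
  -- T sees derivatives on K, so R^m w must vanish near each point of K. Continuity of φ^m extends
  -- the inclusion from orbits starting in K to nearby points.
  have h2 : ∀ᶠ y in 𝓝 x, φ^[m] y ∈ O := by
    refine (hφ.continuous.iterate m).continuousAt.eventually (hO.mem_nhds ?_)
    rw [hφm x hx]
    exact htO x hx _ hm'
  filter_upwards [h2, U.isOpen.mem_nhds (hKU hx)] with y hy hyU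
  rw [ofContDiffOn_apply _ hyU]
  exact iterate_transport_eq_zero (fun x hx => by simp [hOu x hx]) m y hy

end Support

/-! ### Distributions supported in a point have finite order -/

section PointSupport

/-- The derivative of order N is bounded on a ball. Each application of the mean value inequality on
a ball centered at p lowers the order of the derivative by one and gains one factor ‖x - p‖. -/
theorem exists_norm_iteratedFDeriv_le_pow {E V : Type*} [NormedAddCommGroup E] [NormedSpace ℝ E]
    [FiniteDimensional ℝ E] [NormedAddCommGroup V] [NormedSpace ℝ V] {U : Opens E} {f : E → V}
    (hf : ContDiffOn ℝ ∞ f U) {p : E} (hp : p ∈ U) {N : ℕ}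
    (h : ∀ k < N, iteratedFDeriv ℝ k f p = 0) :
    ∃ r > 0, Metric.closedBall p r ⊆ U ∧ ∃ C ≥ (0 : ℝ), ∀ j k, k + j = N →
      ∀ x ∈ Metric.closedBall p r, ‖iteratedFDeriv ℝ k f x‖ ≤ C * ‖x - p‖ ^ j := by
  obtain ⟨r, hr, hrU⟩ := Metric.nhds_basis_closedBall.mem_iff.1 (U.isOpen.mem_nhds hp)
  obtain ⟨C, hC⟩ := (isCompact_closedBall p r).exists_bound_of_continuousOn
    ((continuousOn_iteratedFDeriv hf N).mono hrU)
  refine ⟨r, hr, hrU, max C 0, le_max_right _ _, fun j => ?_⟩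
  induction j with
  | zero =>
    intro k hk x hx
    rw [add_zero] at hk
    rw [pow_zero, mul_one, hk]
    exact (hC x hx).trans (le_max_left _ _)
  | succ j ih =>
    intro k hk x hx
    have hx' : ‖x - p‖ ≤ r := mem_closedBall_iff_norm.1 hx
    have hsub : Metric.closedBall p ‖x - p‖ ⊆ Metric.closedBall p r :=
      Metric.closedBall_subset_closedBall hx'
    have h1 := (convex_closedBall p ‖x - p‖).norm_image_sub_le_of_norm_fderiv_le (𝕜 := ℝ)
      (f := iteratedFDeriv ℝ k f) (C := max C 0 * ‖x - p‖ ^ j) (x := p) (y := x)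
      (fun z hz => ((hf.contDiffAt (U.isOpen.mem_nhds (hrU (hsub hz)))).differentiableAt_iteratedFDeriv
        (by exact_mod_cast WithTop.coe_lt_top _)))
      (fun z hz => by
        rw [norm_fderiv_iteratedFDeriv]
        refine (ih (k + 1) (by omega) z (hsub hz)).trans ?_
        have := mem_closedBall_iff_norm.1 hz
        have := le_max_right C 0
        gcongr)
      (Metric.mem_closedBall_self (norm_nonneg _)) (mem_closedBall_iff_norm.2 le_rfl)
    rw [h k (by omega), sub_zero] at h1
    rwa [pow_succ, ← mul_assoc]

variable {𝕜 : Type*} [RCLike 𝕜] {E : Type*} [NormedAddCommGroup E] [NormedSpace ℝ E]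
  [FiniteDimensional ℝ E] {U : Opens E}
  {V : Type*} [NormedAddCommGroup V] [NormedSpace ℝ V] [NormedSpace 𝕜 V] [IsScalarTower ℝ 𝕜 V]

/-- A scaled cutoff function has derivatives that grow at most like powers of the scale. -/
theorem exists_scaled_cutoff (p : E) (M : ℕ) : ∃ C ≥ (0 : ℝ), ∀ ε > (0 : ℝ), ∃ χ : E → ℝ,
    ContDiff ℝ ∞ χ ∧ tsupport χ ⊆ Metric.closedBall p (2 * ε) ∧ (∀ᶠ x in 𝓝 p, χ x = 1) ∧
      ∀ k ≤ M, ∀ x, ‖iteratedFDeriv ℝ k χ x‖ ≤ C * (ε⁻¹) ^ k := by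
  let θ : ContDiffBump (0 : E) := ⟨1, 2, one_pos, one_lt_two⟩
  have hθ : ContDiff ℝ ∞ θ := θ.contDiff
  have hb : ∀ k : ℕ, ∃ C, ∀ x, ‖iteratedFDeriv ℝ k θ x‖ ≤ C := fun k =>
    (θ.hasCompactSupport.iteratedFDeriv (𝕜 := ℝ) k).exists_bound_of_continuous
      (hθ.continuous_iteratedFDeriv (by exact_mod_cast le_top))
  choose C hC using hb
  have hC0 : ∀ k, 0 ≤ C k := fun k => (norm_nonneg _).trans (hC k 0)
  refine ⟨∑ k ∈ Finset.range (M + 1), C k, Finset.sum_nonneg fun k _ => hC0 k, fun ε hε => ?_⟩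
  have hsm : ContDiff ℝ ∞ (fun x => θ (ε⁻¹ • (x - p))) :=
    hθ.comp ((contDiff_id.sub contDiff_const).const_smul ε⁻¹)
  refine ⟨fun x => θ (ε⁻¹ • (x - p)), hsm, ?_, ?_, fun k hk x => ?_⟩
  · refine closure_minimal (fun x hx => ?_) Metric.isClosed_closedBall
    have h1 : ε⁻¹ • (x - p) ∈ Function.support θ := hx
    rw [θ.support_eq, mem_ball_zero_iff, norm_smul, norm_inv, Real.norm_of_nonneg hε.le,
      inv_mul_lt_iff₀ hε] at h1
    rw [mem_closedBall_iff_norm]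
    have h2 : θ.rOut = 2 := rfl
    rw [h2] at h1
    linarith
  · filter_upwards [Metric.closedBall_mem_nhds p hε] with x hx
    refine θ.one_of_mem_closedBall ?_
    rw [mem_closedBall_zero_iff, norm_smul, norm_inv, Real.norm_of_nonneg hε.le,
      inv_mul_le_iff₀ hε]
    have h2 : θ.rIn = 1 := rfl
    rw [h2, mul_one]
    exact mem_closedBall_iff_norm.1 hx
  · rw [iteratedFDeriv_comp_sub (f := fun y => θ (ε⁻¹ • y)),
      iteratedFDeriv_comp_const_smul ε⁻¹ (hθ.of_le (by exact_mod_cast le_top)), norm_smul, norm_pow,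
      norm_inv, Real.norm_of_nonneg hε.le, mul_comm]
    refine mul_le_mul_of_nonneg_right ((hC k _).trans ?_) (by positivity)
    exact Finset.single_le_sum (f := C) (fun k _ => hC0 k) (Finset.mem_range.2 (by omega))

/-- A distribution that is supported in a point vanishes on all functions that vanish to a
sufficiently high order there. -/
theorem exists_forall_vanishing_apply_eq_zero {p : U} {T : CompactDistribution 𝕜 U V}
    (hT : ∀ u : SmoothFun 𝕜 U V, ⇑u =ᶠ[𝓝 (p : E)] 0 → T u = 0) :
    ∃ M : ℕ, ∀ u ∈ vanishing 𝕜 V p M, T u = 0 := by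
  obtain ⟨K, hK, hKU, M, C, hC, hTK⟩ := exists_isBoundedOn T
  -- T is bounded by derivatives of order at most M; one more order of vanishing leaves a factor ε
  -- in the estimate for u times a cutoff at scale ε. That product has the same value under T as u.
  refine ⟨M + 1, fun u hu => ?_⟩
  obtain ⟨r, hr, hrU, D, hD, hDu⟩ := exists_norm_iteratedFDeriv_le_pow u.contDiffOn p.2 hu
  obtain ⟨C', hC', hχ⟩ := exists_scaled_cutoff (p : E) M
  set Q : ℝ := ∑ k ∈ Finset.range (M + 1), ∑ i ∈ Finset.range (k + 1),
    (k.choose i : ℝ) * C' * (D * 2 ^ (M + 1 - (k - i))) with hQ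
  have hQ0 : 0 ≤ Q := Finset.sum_nonneg fun k _ => Finset.sum_nonneg fun i _ => by positivity
  have key : ∀ ε > 0, ε ≤ 1 → 2 * ε ≤ r → ‖T u‖ ≤ C * Q * ε := by
    intro ε hε hε1 hεr
    obtain ⟨χ, hχs, hχt, hχ1, hχb⟩ := hχ ε hε
    have hs : ContDiffOn ℝ ∞ (fun x => χ x • u x) U := hχs.contDiffOn.smul u.contDiffOn
    have h1 : T u = T (ofContDiffOn 𝕜 hs) := by
      rw [← sub_eq_zero, ← map_sub]
      refine hT _ ?_
      filter_upwards [hχ1, U.isOpen.mem_nhds p.2] with x hx hxU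
      rw [SmoothFun.coe_sub, Pi.sub_apply, ofContDiffOn_apply hs hxU, hx, one_smul, sub_self]
      rfl
    rw [h1, mul_assoc]
    refine hTK _ _ (by positivity) fun k hk x hx => ?_
    rw [((ofContDiffOn_eventuallyEq hs (hKU hx)).iteratedFDeriv ℝ k).eq_of_nhds]
    by_cases hxb : x ∈ Metric.closedBall (p : E) (2 * ε)
    · have hx2 : ‖x - p‖ ≤ 2 * ε := mem_closedBall_iff_norm.1 hxb
      have h2 := norm_iteratedFDerivWithin_smul_le (n := k) (N := ∞) hχs.contDiffOn u.contDiffOn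
        U.isOpen.uniqueDiffOn (hKU hx) (by exact_mod_cast le_top)
      simp only [fun (F : Type _) [NormedAddCommGroup F] [NormedSpace ℝ F] (m : ℕ) (f : E → F) =>
        iteratedFDerivWithin_of_isOpen (𝕜 := ℝ) (f := f) m U.isOpen (hKU hx)] at h2
      refine h2.trans ?_
      calc _ ≤ ∑ i ∈ Finset.range (k + 1),
            (k.choose i : ℝ) * C' * (D * 2 ^ (M + 1 - (k - i))) * ε := by
              refine Finset.sum_le_sum fun i hi => ?_
              have hik : i ≤ k := by
                have := Finset.mem_range.1 hi
                omega
              have h3 := hχb i (hik.trans hk) x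
              have h4 := hDu (M + 1 - (k - i)) (k - i) (by omega) x
                (Metric.closedBall_subset_closedBall hεr hxb)
              have h5 : ‖x - p‖ ^ (M + 1 - (k - i)) ≤ (2 * ε) ^ (M + 1 - (k - i)) := by gcongr
              -- In the Leibniz rule, i derivatives of the cutoff cost ε^(-i), while k - i
              -- derivatives of u contribute ε^(M+1-(k-i)). The total exponent M + 1 - k is at least
              -- 1.
              have h6 : ε⁻¹ ^ i * ε ^ (M + 1 - (k - i)) ≤ ε := by
                have h7 : M + 1 - (k - i) = i + ((M - k) + 1) := by omega
                rw [h7, pow_add, ← mul_assoc, ← mul_pow, inv_mul_cancel₀ hε.ne', one_pow, one_mul,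
                  pow_succ]
                exact mul_le_of_le_one_left hε.le (pow_le_one₀ hε.le hε1)
              calc _ ≤ (k.choose i : ℝ) * (C' * ε⁻¹ ^ i) *
                    (D * (2 * ε) ^ (M + 1 - (k - i))) := by
                      gcongr
                      exact h4.trans (by gcongr)
                _ = (k.choose i : ℝ) * C' * (D * 2 ^ (M + 1 - (k - i))) *
                    (ε⁻¹ ^ i * ε ^ (M + 1 - (k - i))) := by rw [mul_pow]; ring
                _ ≤ _ := by gcongr
        _ ≤ Q * ε := by
              rw [← Finset.sum_mul]
              refine mul_le_mul_of_nonneg_right ?_ hε.le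
              exact Finset.single_le_sum (f := fun k => ∑ i ∈ Finset.range (k + 1),
                (k.choose i : ℝ) * C' * (D * 2 ^ (M + 1 - (k - i))))
                (fun k _ => Finset.sum_nonneg fun i _ => by positivity)
                (Finset.mem_range.2 (by omega))
    · have h2 : (fun x => χ x • u x) =ᶠ[𝓝 x] 0 := by
        have h3 : χ =ᶠ[𝓝 x] 0 := notMem_tsupport_iff_eventuallyEq.1 fun h => hxb (hχt h)
        filter_upwards [h3] with y hy
        simp [hy]
      rw [iteratedFDeriv_eq_zero_of_eventuallyEq h2, norm_zero]
      positivity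
  rw [← norm_le_zero_iff]
  have hlim : Tendsto (fun ε : ℝ => C * Q * ε) (𝓝[>] 0) (𝓝 0) := by
    have : Tendsto (fun ε : ℝ => C * Q * ε) (𝓝 0) (𝓝 (C * Q * 0)) := by
      exact (continuous_const.mul continuous_id).tendsto 0
    rw [mul_zero] at this
    exact this.mono_left nhdsWithin_le_nhds
  refine ge_of_tendsto hlim ?_
  have hmin : (0 : ℝ) < min 1 (r / 2) := by positivity
  filter_upwards [Ioc_mem_nhdsGT hmin] with ε hε
  exact key ε hε.1 (hε.2.trans (min_le_left _ _))
    (by have := hε.2.trans (min_le_right _ _); linarith)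

end PointSupport

/-! ### Symmetry of iterated derivatives -/

section Symmetry

variable {E : Type*} [NormedAddCommGroup E] [NormedSpace ℝ E] {U : Opens E}
  {V : Type*} [NormedAddCommGroup V] [NormedSpace ℝ V]

theorem differentiableAt_iteratedFDeriv_of_contDiffOn {f : E → V} (hf : ContDiffOn ℝ ∞ f U) (k : ℕ)
    {x : E} (hx : x ∈ U) : DifferentiableAt ℝ (iteratedFDeriv ℝ k f) x :=
  (hf.contDiffAt (U.isOpen.mem_nhds hx)).differentiableAt_iteratedFDeriv
    (by exact_mod_cast WithTop.coe_lt_top _)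

theorem fderiv_iteratedFDeriv_apply {f : E → V} (hf : ContDiffOn ℝ ∞ f U) (k : ℕ)
    {x : E} (hx : x ∈ U) (a : E) (w : Fin k → E) :
    fderiv ℝ (iteratedFDeriv ℝ k f) x a w = fderiv ℝ (fun y => iteratedFDeriv ℝ k f y w) x a := by
  have h1 := (ContinuousMultilinearMap.apply ℝ (fun _ : Fin k => E) V w).hasFDerivAt.comp x
    (differentiableAt_iteratedFDeriv_of_contDiffOn hf k hx).hasFDerivAt
  have h2 : HasFDerivAt (fun y => iteratedFDeriv ℝ k f y w) _ x := h1
  rw [h2.fderiv]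
  rfl

/-- Exchanging the first two slots is the symmetry of the second derivative of a lower iterated
derivative. Any other adjacent swap leaves the outermost derivative alone and is covered by
induction at all points near x. -/
theorem iteratedFDeriv_comp_swap (k : ℕ) : ∀ {f : E → V} (_ : ContDiffOn ℝ ∞ f U) {x : E}
    (_ : x ∈ U) (i : Fin k) (v : Fin (k + 1) → E),
    iteratedFDeriv ℝ (k + 1) f x (v ∘ Equiv.swap i.castSucc i.succ) =
      iteratedFDeriv ℝ (k + 1) f x v := by
  induction k with
  | zero => exact fun _ _ _ i => i.elim0
  | succ k ih =>
    intro f hf x hx i v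
    rw [iteratedFDeriv_succ_apply_left, iteratedFDeriv_succ_apply_left,
      fderiv_iteratedFDeriv_apply hf _ hx, fderiv_iteratedFDeriv_apply hf _ hx]
    induction i using Fin.cases with
    | zero =>
      have hsw : ∀ w : Fin (k + 2) → E, fderiv ℝ (fun y => iteratedFDeriv ℝ (k + 1) f y
          (Fin.tail w)) x (w 0) = fderiv ℝ (fderiv ℝ (iteratedFDeriv ℝ k f)) x (w 0) (w 1)
            (Fin.tail (Fin.tail w)) := fun w => by
        have hd : DifferentiableAt ℝ (fderiv ℝ (iteratedFDeriv ℝ k f)) x :=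
          (((hf.contDiffAt (U.isOpen.mem_nhds hx)).iteratedFDeriv_right (m := ∞)
            (by exact_mod_cast le_rfl)).fderiv_right (m := ∞)
              (by exact_mod_cast le_rfl)).differentiableAt (by simp)
        have h1 := (ContinuousMultilinearMap.apply ℝ (fun _ : Fin k => E) V
          (Fin.tail (Fin.tail w))).hasFDerivAt.comp x
            (hd.hasFDerivAt.clm_apply (hasFDerivAt_const (w 1) x))
        have h2 : HasFDerivAt (fun y => iteratedFDeriv ℝ (k + 1) f y (Fin.tail w)) _ x := h1
        rw [h2.fderiv]
        simp
      have hs : IsSymmSndFDerivAt ℝ (iteratedFDeriv ℝ k f) x :=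
        ((hf.contDiffAt (U.isOpen.mem_nhds hx)).iteratedFDeriv_right (m := ∞)
          (by exact_mod_cast le_rfl)).isSymmSndFDerivAt (by
            rw [minSmoothness_of_isRCLikeNormedField]
            exact WithTop.coe_le_coe.2 le_top)
      rw [hsw, hsw]
      have e0 : (v ∘ Equiv.swap (Fin.castSucc (0 : Fin (k + 1))) (Fin.succ 0)) 0 = v 1 := by simp
      have e1 : (v ∘ Equiv.swap (Fin.castSucc (0 : Fin (k + 1))) (Fin.succ 0)) 1 = v 0 := by simp
      have e2 : Fin.tail (Fin.tail (v ∘ Equiv.swap (Fin.castSucc (0 : Fin (k + 1))) (Fin.succ 0))) =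
          Fin.tail (Fin.tail v) := by
        ext j
        simp only [Fin.tail, Function.comp_apply]
        rw [Equiv.swap_apply_of_ne_of_ne]
        · simp [Fin.ext_iff]
        · simp [Fin.ext_iff]
      rw [e0, e1, e2, hs.eq]
    | succ j =>
      have e0 : (v ∘ Equiv.swap (Fin.castSucc j.succ) (Fin.succ j.succ)) 0 = v 0 := by
        simp only [Function.comp_apply]
        rw [Equiv.swap_apply_of_ne_of_ne]
        · simp [Fin.ext_iff]
        · simp [Fin.ext_iff]
      have e1 : Fin.tail (v ∘ Equiv.swap (Fin.castSucc j.succ) (Fin.succ j.succ)) =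
          Fin.tail v ∘ Equiv.swap j.castSucc j.succ := by
        ext l
        simp only [Fin.tail, Function.comp_apply]
        congr 1
        rw [← Fin.succ_castSucc, (Fin.succ_injective _).swap_apply]
      rw [e0, e1]
      have h1 : (fun y => iteratedFDeriv ℝ (k + 1) f y
          (Fin.tail v ∘ Equiv.swap j.castSucc j.succ)) =ᶠ[𝓝 x]
            fun y => iteratedFDeriv ℝ (k + 1) f y (Fin.tail v) := by
        filter_upwards [U.isOpen.mem_nhds hx] with y hy
        exact ih hf hy j _
      rw [h1.fderiv_eq]

/-- The iterated derivatives of a smooth function are symmetric. -/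
theorem iteratedFDeriv_comp_perm_of_contDiffOn {f : E → V} (hf : ContDiffOn ℝ ∞ f U) {x : E}
    (hx : x ∈ U) {k : ℕ} (σ : Equiv.Perm (Fin k)) (v : Fin k → E) :
    iteratedFDeriv ℝ k f x (v ∘ σ) = iteratedFDeriv ℝ k f x v := by
  cases k with
  | zero => congr 1; exact Subsingleton.elim _ _
  | succ k =>
    have hσ : σ ∈ Submonoid.closure (range fun i : Fin k => Equiv.swap i.castSucc i.succ) := by
      rw [Equiv.Perm.mclosure_swap_castSucc_succ]
      exact Submonoid.mem_top σ
    induction hσ using Submonoid.closure_induction generalizing v with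
    | mem τ hτ =>
      obtain ⟨i, rfl⟩ := hτ
      exact iteratedFDeriv_comp_swap k hf hx i v
    | one => rfl
    | mul τ τ' _ _ h1 h2 =>
      have : v ∘ ⇑(τ * τ') = (v ∘ τ) ∘ τ' := rfl
      rw [this, h2, h1]

end Symmetry

/-! ### Eigenvalues of sums of commuting operators -/

section Commuting

open Polynomial

open scoped IsMulCommutative in
/-- If `λ` is not a sum of roots of polynomials that annihilate commuting elements `x i`, then
`∑ x i - λ` is invertible. -/
theorem isUnit_sum_sub_algebraMap {𝕜 R ι : Type*} [RCLike 𝕜] [Ring R] [Algebra 𝕜 R] [Fintype ι]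
    {x : ι → R} (hx : ∀ i j, x i * x j = x j * x i) {P : ι → 𝕜[X]} (hP : ∀ i, (P i).Monic)
    (hPx : ∀ i, aeval (x i) (P i) = 0) {lam : 𝕜}
    (hlam : ∀ z : ι → ℂ, (∀ i, z i ∈ ((P i).map (toComplex 𝕜)).roots) →
      toComplex 𝕜 lam ≠ ∑ i, z i) :
    IsUnit (∑ i, x i - algebraMap 𝕜 R lam) := by
  -- The algebra generated by the commuting elements is commutative, and a unit of it is a unit of
  -- R.
  let S : Subalgebra 𝕜 R := Algebra.adjoin 𝕜 (range x)
  have hS : IsMulCommutative S := Algebra.isMulCommutative_adjoin 𝕜 (by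
    rintro _ ⟨i, rfl⟩ _ ⟨j, rfl⟩
    exact hx i j)
  let y : ι → S := fun i => ⟨x i, Algebra.subset_adjoin (mem_range_self i)⟩
  have hy : ∀ i, aeval (y i) (P i) = 0 := fun i => by
    apply Subtype.val_injective
    have h1 := Polynomial.aeval_algHom_apply S.val (y i) (P i)
    have h2 : S.val (y i) = x i := rfl
    rw [h2, hPx] at h1
    exact h1.symm
  have hint : ∀ a : S, IsIntegral 𝕜 a := by
    rintro ⟨a, ha⟩
    induction ha using Algebra.adjoin_induction with
    | mem a ha =>
      obtain ⟨i, rfl⟩ := ha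
      exact ⟨P i, hP i, hy i⟩
    | algebraMap r => exact isIntegral_algebraMap (A := S) (x := r)
    | add a b ha hb h1 h2 => exact h1.add h2
    | mul a b ha hb h1 h2 => exact h1.mul h2
  suffices h : IsUnit (∑ i, y i - algebraMap 𝕜 S lam) by
    have := h.map S.val
    simpa [y] using this
  by_contra hnu
  -- A non-unit lies in a maximal ideal. The residue field is algebraic over 𝕜 and hence embeds into
  -- ℂ; the images of the generators are roots of the P i and add up to λ, which is excluded.
  obtain ⟨m, hm, hmem⟩ := exists_max_ideal_of_mem_nonunits hnu
  let _ : Field (S ⧸ m) := Ideal.Quotient.field m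
  let _ : Algebra 𝕜 ℂ := (toComplex 𝕜).toAlgebra
  have : Algebra.IsIntegral 𝕜 (S ⧸ m) := ⟨fun a => by
    obtain ⟨b, rfl⟩ := Ideal.Quotient.mk_surjective a
    exact (hint b).map (Ideal.Quotient.mkₐ 𝕜 m)⟩
  let φ : (S ⧸ m) →ₐ[𝕜] ℂ := IsAlgClosed.lift
  let ψ : S →ₐ[𝕜] ℂ := φ.comp (Ideal.Quotient.mkₐ 𝕜 m)
  have h0 : ψ (∑ i, y i - algebraMap 𝕜 S lam) = 0 := by
    have : Ideal.Quotient.mkₐ 𝕜 m (∑ i, y i - algebraMap 𝕜 S lam) = 0 :=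
      Ideal.Quotient.eq_zero_iff_mem.2 hmem
    rw [AlgHom.comp_apply, this, map_zero]
  rw [map_sub, map_sum, AlgHom.commutes, sub_eq_zero] at h0
  refine hlam (fun i => ψ (y i)) (fun i => ?_) h0.symm
  rw [Polynomial.mem_roots ((hP i).map _).ne_zero, Polynomial.IsRoot, Polynomial.eval_map]
  have h1 := Polynomial.aeval_algHom_apply ψ (y i) (P i)
  rw [hy, map_zero] at h1
  exact h1

end Commuting

/-! ### The action of `∇_X + A` on homogeneous polynomials -/

section Multilinear

open Polynomial

variable (𝕜 : Type*) [RCLike 𝕜] {E : Type*} [NormedAddCommGroup E] [NormedSpace ℝ E]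
  {V : Type*} [NormedAddCommGroup V] [NormedSpace ℝ V] [NormedSpace 𝕜 V] [IsScalarTower ℝ 𝕜 V]
  {k : ℕ}

variable (V) in
/-- Precomposition of a multilinear map with a linear map in one of the slots. -/
noncomputable def slotOp (i : Fin k) (M : E →L[ℝ] E) : Module.End 𝕜 (E [×k]→L[ℝ] V) where
  toFun g := g.compContinuousLinearMap
    (Function.update (fun _ => ContinuousLinearMap.id ℝ E) i M)
  map_add' _ _ := rfl
  map_smul' _ _ := rfl

variable (E k) in
/-- Postcomposition of a multilinear map with a linear map. -/
noncomputable def postOp (a : V →L[𝕜] V) : Module.End 𝕜 (E [×k]→L[ℝ] V) where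
  toFun g := (a.restrictScalars ℝ).compContinuousMultilinearMap g
  map_add' g h := by ext v; exact map_add a (g v) (h v)
  map_smul' c g := by ext v; exact map_smul a c (g v)

variable {𝕜}

theorem slotOp_apply (i : Fin k) (M : E →L[ℝ] E) (g : E [×k]→L[ℝ] V) (v : Fin k → E) :
    slotOp 𝕜 V i M g v = g (Function.update v i (M (v i))) := by
  change g _ = _
  congr 1
  funext j
  rcases eq_or_ne j i with rfl | h
  · simp
  · simp [Function.update_of_ne h]

theorem postOp_apply (a : V →L[𝕜] V) (g : E [×k]→L[ℝ] V) (v : Fin k → E) :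
    postOp 𝕜 E k a g v = a (g v) := rfl

theorem slotOp_comm (i j : Fin k) (M : E →L[ℝ] E) :
    slotOp 𝕜 V i M * slotOp 𝕜 V j M = slotOp 𝕜 V j M * slotOp 𝕜 V i M := by
  rcases eq_or_ne i j with rfl | h
  · rfl
  · ext g v
    simp only [Module.End.mul_apply, slotOp_apply, Function.update_of_ne h,
      Function.update_of_ne h.symm]
    rw [Function.update_comm h]

theorem slotOp_postOp_comm (i : Fin k) (M : E →L[ℝ] E) (a : V →L[𝕜] V) :
    slotOp 𝕜 V i M * postOp 𝕜 E k a = postOp 𝕜 E k a * slotOp 𝕜 V i M := rfl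

theorem slotOp_pow_apply (i : Fin k) (M : E →L[ℝ] E) (n : ℕ) (g : E [×k]→L[ℝ] V) (v : Fin k → E) :
    (slotOp 𝕜 V i M ^ n) g v =
      g (Function.update v i (((M : E →ₗ[ℝ] E) ^ n) (v i))) := by
  induction n generalizing v with
  | zero => simp
  | succ n ih =>
    rw [pow_succ', Module.End.mul_apply, slotOp_apply, ih, Function.update_idem,
      Function.update_self, pow_succ, Module.End.mul_apply]
    rfl

theorem aeval_slotOp_apply (i : Fin k) (M : E →L[ℝ] E) (P : ℝ[X]) (g : E [×k]→L[ℝ] V)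
    (v : Fin k → E) : aeval (slotOp 𝕜 V i M) (P.map (algebraMap ℝ 𝕜)) g v =
      g (Function.update v i (aeval (M : E →ₗ[ℝ] E) P (v i))) := by
  induction P using Polynomial.induction_on' with
  | add P Q hP hQ =>
    rw [Polynomial.map_add, map_add, map_add, LinearMap.add_apply, LinearMap.add_apply,
      g.map_update_add, ← hP, ← hQ]
    rfl
  | monomial n c =>
    rw [Polynomial.map_monomial, aeval_monomial, aeval_monomial, Module.End.mul_apply,
      Module.End.mul_apply, Module.algebraMap_end_apply, Module.algebraMap_end_apply,
      g.map_update_smul, algebraMap_smul, ← slotOp_pow_apply (𝕜 := 𝕜)]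
    rfl

/-- Cayley–Hamilton in one slot: a polynomial in the slot operator acts as the same polynomial of M
in that slot. -/
theorem aeval_slotOp_charpoly [FiniteDimensional ℝ E] (i : Fin k) (M : E →L[ℝ] E) :
    aeval (slotOp 𝕜 V i M) ((M : E →ₗ[ℝ] E).charpoly.map (algebraMap ℝ 𝕜)) = 0 := by
  ext g v
  rw [aeval_slotOp_apply, LinearMap.aeval_self_charpoly]
  exact g.map_update_zero v i

theorem aeval_postOp_apply (a : V →L[𝕜] V) (P : 𝕜[X]) (g : E [×k]→L[ℝ] V)
    (v : Fin k → E) : aeval (postOp 𝕜 E k a) P g v = aeval (a : V →ₗ[𝕜] V) P (g v) := by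
  have hpow : ∀ (n : ℕ) (g : E [×k]→L[ℝ] V), (postOp 𝕜 E k a ^ n) g v =
      ((a : V →ₗ[𝕜] V) ^ n) (g v) := fun n => by
    induction n with
    | zero => simp
    | succ n ih =>
      intro g
      rw [pow_succ, Module.End.mul_apply, ih, pow_succ, Module.End.mul_apply]
      rfl
  induction P using Polynomial.induction_on' with
  | add P Q hP hQ =>
    rw [map_add, map_add, LinearMap.add_apply, LinearMap.add_apply, ← hP, ← hQ]
    rfl
  | monomial n c =>
    rw [aeval_monomial, aeval_monomial, Module.End.mul_apply, Module.End.mul_apply,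
      Module.algebraMap_end_apply, Module.algebraMap_end_apply, ← hpow]
    rfl

theorem aeval_postOp_charpoly [FiniteDimensional 𝕜 V] (a : V →L[𝕜] V) :
    aeval (postOp 𝕜 E k a) (a : V →ₗ[𝕜] V).charpoly = 0 := by
  ext g v
  rw [aeval_postOp_apply, LinearMap.aeval_self_charpoly]
  rfl

/-- The operator induced by `∇_X + A` on homogeneous polynomials, lifted to multilinear maps. -/
noncomputable def symbolOp (k : ℕ) (M : E →L[ℝ] E) (a : V →L[𝕜] V) :
    Module.End 𝕜 (E [×k]→L[ℝ] V) :=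
  ∑ i, slotOp 𝕜 V i M + postOp 𝕜 E k a

theorem toComplex_comp_algebraMap : (toComplex 𝕜).comp (algebraMap ℝ 𝕜) = toComplex ℝ := by
  ext r
  apply Complex.ext <;> simp [toComplex]

/-- The slot operators and the action on values commute, and each is annihilated by the
characteristic polynomial of M or a. Working with all multilinear maps, not just symmetric ones,
keeps the slots independent; no eigenbasis is needed. -/
theorem isUnit_symbolOp_sub [FiniteDimensional ℝ E] [FiniteDimensional 𝕜 V] (k : ℕ)
    (M : E →L[ℝ] E) (a : V →L[𝕜] V) {lam : 𝕜}
    (h : ∀ z : Fin k → ℂ, (∀ i, z i ∈ eigenvalues (M : E →ₗ[ℝ] E)) →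
      ∀ ρ ∈ eigenvalues (a : V →ₗ[𝕜] V), toComplex 𝕜 lam ≠ ∑ i, z i + ρ) :
    IsUnit (symbolOp k M a - algebraMap 𝕜 (Module.End 𝕜 (E [×k]→L[ℝ] V)) lam) := by
  have key := isUnit_sum_sub_algebraMap (𝕜 := 𝕜) (R := Module.End 𝕜 (E [×k]→L[ℝ] V))
    (x := fun o : Option (Fin k) => o.elim (postOp 𝕜 E k a) fun i => slotOp 𝕜 V i M)
    (P := fun o => o.elim (a : V →ₗ[𝕜] V).charpoly
      fun _ => (M : E →ₗ[ℝ] E).charpoly.map (algebraMap ℝ 𝕜)) (lam := lam) ?_ ?_ ?_ ?_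
  · rw [Fintype.sum_option, add_comm (Option.elim _ _ _)] at key
    exact key
  · rintro (_ | i) (_ | j)
    · rfl
    · exact (slotOp_postOp_comm j M a).symm
    · exact slotOp_postOp_comm i M a
    · exact slotOp_comm i j M
  · rintro (_ | i)
    · exact LinearMap.charpoly_monic _
    · exact (LinearMap.charpoly_monic _).map _
  · rintro (_ | i)
    · exact aeval_postOp_charpoly a
    · exact aeval_slotOp_charpoly i M
  · intro z hz
    rw [Fintype.sum_option, add_comm]
    refine h (fun i => z (some i)) (fun i => ?_) (z none) (hz none)
    have := hz (some i)
    simp only [Option.elim, Polynomial.map_map, toComplex_comp_algebraMap] at this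
    exact this

end Multilinear

/-! ### Leading Taylor terms and the linearized operator -/

section Homogeneous

variable {𝕜 : Type*} [RCLike 𝕜] {E : Type*} [NormedAddCommGroup E] [NormedSpace ℝ E] {U : Opens E}
  {V : Type*} [NormedAddCommGroup V] [NormedSpace ℝ V] [NormedSpace 𝕜 V] [IsScalarTower ℝ 𝕜 V]
  {k : ℕ}

/-- The homogeneous polynomial in `x - p` defined by a multilinear map. -/
def homogeneousFun (p : E) (g : E [×k]→L[ℝ] V) (x : E) : V := g fun _ => x - p

omit [NormedSpace 𝕜 V] [IsScalarTower ℝ 𝕜 V] in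
theorem contDiff_homogeneousFun (p : E) (g : E [×k]→L[ℝ] V) : ContDiff ℝ ∞ (homogeneousFun p g) :=
  g.contDiff.comp (contDiff_pi.2 fun _ => contDiff_id.sub contDiff_const)

theorem hasFDerivAt_homogeneousFun (p : E) (g : E [×k]→L[ℝ] V) (x : E) :
    HasFDerivAt (homogeneousFun p g) (g.linearDeriv (fun _ => x - p) ∘L
      ContinuousLinearMap.pi fun _ => ContinuousLinearMap.id ℝ E) x :=
  (g.hasFDerivAt fun _ => x - p).comp x
    (hasFDerivAt_pi.2 fun _ => (hasFDerivAt_id x).sub_const p)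

theorem fderiv_homogeneousFun (p : E) (g : E [×k]→L[ℝ] V) (x h : E) :
    fderiv ℝ (homogeneousFun p g) x h = ∑ i, g (Function.update (fun _ => x - p) i h) := by
  rw [(hasFDerivAt_homogeneousFun p g x).fderiv]
  simp [ContinuousMultilinearMap.linearDeriv_apply]

theorem homogeneousFun_symbolOp (p : E) (M : E →L[ℝ] E) (a : V →L[𝕜] V) (g : E [×k]→L[ℝ] V)
    (x : E) : homogeneousFun p (symbolOp k M a g) x =
      fderiv ℝ (homogeneousFun p g) x (M (x - p)) + a (homogeneousFun p g x) := by
  rw [fderiv_homogeneousFun]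
  simp only [homogeneousFun, symbolOp, LinearMap.add_apply, LinearMap.sum_apply,
    _root_.add_apply, _root_.sum_apply, slotOp_apply,
    postOp_apply]

/-- The derivative of order j of the k-linear map g at v is bounded by a multiple of ‖v‖^(k-j),
which is zero at v = 0 for j < k. -/
theorem iteratedFDeriv_homogeneousFun_of_lt (p : E) (g : E [×k]→L[ℝ] V) {j : ℕ} (hj : j < k) :
    iteratedFDeriv ℝ j (homogeneousFun p g) p = 0 := by
  have h1 := (ContinuousLinearMap.pi fun _ : Fin k => ContinuousLinearMap.id ℝ E)
    |>.iteratedFDeriv_comp_right (g.contDiff (n := ∞)) (0 : E) (i := j) (by exact_mod_cast le_top)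
  have h2 : iteratedFDeriv ℝ j (homogeneousFun p g) p = iteratedFDeriv ℝ j
      (g ∘ (ContinuousLinearMap.pi fun _ : Fin k => ContinuousLinearMap.id ℝ E)) 0 := by
    rw [← sub_self p, ← iteratedFDeriv_comp_sub]
    rfl
  have h3 := g.norm_iteratedFDeriv_le j 0
  rw [norm_zero, Fintype.card_fin, zero_pow (by omega), mul_zero, norm_le_zero_iff] at h3
  rw [h2, h1, map_zero, h3]
  ext v
  rfl

theorem iteratedFDeriv_homogeneousFun_self (p : E) (g : E [×k]→L[ℝ] V) (v : Fin k → E) :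
    iteratedFDeriv ℝ k (homogeneousFun p g) p v = ∑ σ : Equiv.Perm (Fin k), g (v ∘ σ) := by
  have h2 : iteratedFDeriv ℝ k (homogeneousFun p g) p =
      iteratedFDeriv ℝ k (fun x => g fun _ => x) (p - p) := by
    rw [← iteratedFDeriv_comp_sub]
    rfl
  rw [h2, ContinuousMultilinearMap.iteratedFDeriv_comp_diagonal]
  rfl

variable (𝕜 U) in
/-- The homogeneous polynomials as elements of `C^∞(U, V)`. -/
noncomputable def homogeneous (p : E) (g : E [×k]→L[ℝ] V) : SmoothFun 𝕜 U V :=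
  ofContDiffOn 𝕜 (contDiff_homogeneousFun p g).contDiffOn

theorem homogeneous_eventuallyEq (p : E) (g : E [×k]→L[ℝ] V) {x : E} (hx : x ∈ U) :
    ⇑(homogeneous 𝕜 U p g) =ᶠ[𝓝 x] homogeneousFun p g := ofContDiffOn_eventuallyEq _ hx

theorem homogeneous_sub_smul (p : E) (g h : E [×k]→L[ℝ] V) (c : 𝕜) :
    homogeneous 𝕜 U p (g - c • h) = homogeneous 𝕜 U p g - c • homogeneous 𝕜 U p h := by
  refine DFunLike.ext _ _ fun x => ?_
  by_cases hx : x ∈ U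
  · rw [SmoothFun.coe_sub, SmoothFun.coe_smul, Pi.sub_apply, Pi.smul_apply]
    simp only [homogeneous, ofContDiffOn_apply _ hx]
    rfl
  · rw [SmoothFun.coe_sub, SmoothFun.coe_smul, Pi.sub_apply, Pi.smul_apply]
    simp [SmoothFun.eq_zero _ hx]

/-- A function that vanishes to order `k` is a homogeneous polynomial of degree `k` up to a function
that vanishes to order `k + 1`. -/
theorem sub_homogeneous_mem_vanishing {p : U} {u : SmoothFun 𝕜 U V} (hu : u ∈ vanishing 𝕜 V p k) :
    u - homogeneous 𝕜 U (p : E) ((k.factorial : ℝ)⁻¹ • iteratedFDeriv ℝ k u p) ∈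
      vanishing 𝕜 V p (k + 1) := by
  intro j hj
  set g := (k.factorial : ℝ)⁻¹ • iteratedFDeriv ℝ k u p with hg
  have h1 : iteratedFDeriv ℝ j (u - homogeneous 𝕜 U (p : E) g : SmoothFun 𝕜 U V) p =
      iteratedFDeriv ℝ j u p - iteratedFDeriv ℝ j (homogeneousFun (p : E) g) p := by
    rw [sub_eq_add_neg, ← neg_one_smul 𝕜, SmoothFun.iteratedFDeriv_add _ _ _ p.2,
      SmoothFun.iteratedFDeriv_smul _ _ _ p.2, neg_one_smul, ← sub_eq_add_neg,
      ((homogeneous_eventuallyEq (p : E) g p.2).iteratedFDeriv ℝ j).eq_of_nhds]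
  rw [h1]
  rcases (Nat.lt_succ_iff.1 hj).lt_or_eq with h | rfl
  · rw [hu j h, iteratedFDeriv_homogeneousFun_of_lt _ _ h, sub_zero]
  -- Differentiating the diagonal of g gives a sum over all permutations; for the symmetric
  -- derivative of u its k! terms coincide and cancel the factor 1/k!.
  · ext v
    rw [_root_.sub_apply, iteratedFDeriv_homogeneousFun_self, hg]
    simp only [_root_.smul_apply,
      iteratedFDeriv_comp_perm_of_contDiffOn u.contDiffOn p.2, Finset.sum_const, Finset.card_univ,
      Fintype.card_perm, Fintype.card_fin, ← Nat.cast_smul_eq_nsmul ℝ]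
    rw [smul_smul, mul_inv_cancel₀ (by exact_mod_cast j.factorial_ne_zero), one_smul, sub_self]
    rfl

-- Orders of vanishing add under products: in each term of the Leibniz rule one of the two factors
-- is differentiated too few times to be nonzero.
omit [NormedSpace 𝕜 V] [IsScalarTower ℝ 𝕜 V] in
theorem iteratedFDeriv_clm_apply_eq_zero {W : Type*} [NormedAddCommGroup W] [NormedSpace ℝ W]
    {f : E → W →L[ℝ] V} {h : E → W} (hf : ContDiffOn ℝ ∞ f U) (hh : ContDiffOn ℝ ∞ h U) {p : E}
    (hp : p ∈ U) {a b : ℕ} (hfa : ∀ j < a, iteratedFDeriv ℝ j f p = 0)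
    (hhb : ∀ j < b, iteratedFDeriv ℝ j h p = 0) {j : ℕ} (hj : j < a + b) :
    iteratedFDeriv ℝ j (fun y => f y (h y)) p = 0 := by
  have h1 := norm_iteratedFDerivWithin_clm_apply hf hh U.isOpen.uniqueDiffOn hp
    (n := j) (by exact_mod_cast le_top)
  simp only [fun (F : Type _) [NormedAddCommGroup F] [NormedSpace ℝ F] (m : ℕ) (f : E → F) =>
    iteratedFDerivWithin_of_isOpen (𝕜 := ℝ) (f := f) m U.isOpen hp] at h1
  refine norm_le_zero_iff.1 (h1.trans (Finset.sum_nonpos fun i hi => le_of_eq ?_))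
  have hi' := Finset.mem_range.1 hi
  by_cases h : i < a
  · rw [hfa i h, norm_zero, mul_zero, zero_mul]
  · rw [hhb (j - i) (by omega), norm_zero, mul_zero]

variable {X : E → E} {Γ : E → E →L[ℝ] V →L[𝕜] V} {A : E → V →L[𝕜] V}

/-- On homogeneous polynomials, `∇_X + A` acts like its linearization up to terms of higher
order. -/
theorem operator_homogeneous_sub_mem_vanishing (hX : ContDiffOn ℝ ∞ X U) (hΓ : ContDiffOn ℝ ∞ Γ U)
    (hA : ContDiffOn ℝ ∞ A U) {p : U} (hp : X p = 0) (g : E [×k]→L[ℝ] V) :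
    operator hX hΓ hA (homogeneous 𝕜 U (p : E) g) -
      homogeneous 𝕜 U (p : E) (symbolOp k (fderiv ℝ X p) (A p) g) ∈ vanishing 𝕜 V p (k + 1) := by
  intro j hj
  set Z := zerothOrder X Γ A with hZ
  have hZs : ContDiffOn ℝ ∞ Z U := contDiffOn_zerothOrder hX hΓ hA
  -- The error consists of two products: the derivative of the polynomial, of order k - 1, with h,
  -- of order 2, and the polynomial, of order k, with W, of order 1. The connection does not enter
  -- Z(p), because X(p) = 0.
  let h : E → E := fun y => X y - fderiv ℝ X p (y - p)
  have hh : ContDiffOn ℝ ∞ h U := hX.sub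
    ((fderiv ℝ X p).contDiff.comp (contDiff_id.sub contDiff_const)).contDiffOn
  let W : E → V →L[ℝ] V := fun y => Z y - Z p
  have hW : ContDiffOn ℝ ∞ W U := hZs.sub contDiffOn_const
  have hG := contDiff_homogeneousFun (p : E) g
  have hdG : ContDiff ℝ ∞ (fderiv ℝ (homogeneousFun (p : E) g)) := hG.fderiv_right (by simp)
  have hZp : ∀ v, Z p v = A p v := fun v => by simp [hZ, zerothOrder, hp]
  have heq : ⇑(operator hX hΓ hA (homogeneous 𝕜 U (p : E) g) -
      homogeneous 𝕜 U (p : E) (symbolOp k (fderiv ℝ X p) (A p) g)) =ᶠ[𝓝 (p : E)]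
      (fun y => fderiv ℝ (homogeneousFun (p : E) g) y (h y)) +
        fun y => W y (homogeneousFun (p : E) g y) := by
    filter_upwards [U.isOpen.mem_nhds p.2] with y hy
    have h1 : operator hX hΓ hA (homogeneous 𝕜 U (p : E) g) y =
        operatorFun U X Γ A (homogeneous 𝕜 U (p : E) g) y := rfl
    rw [SmoothFun.coe_sub, Pi.sub_apply, h1, operatorFun_eqOn _ hy, Pi.add_apply,
      (homogeneous_eventuallyEq (p : E) g hy).fderiv_eq,
      (homogeneous_eventuallyEq (p : E) g hy).eq_of_nhds,
      (homogeneous_eventuallyEq (p : E) _ hy).eq_of_nhds, homogeneousFun_symbolOp, Pi.add_apply]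
    simp only [h, W, map_sub, _root_.sub_apply, hZp]
    abel
  have hle : (j : WithTop ℕ∞) ≤ ∞ := by exact_mod_cast le_top
  have hUp := U.isOpen.mem_nhds p.2
  rw [(heq.iteratedFDeriv ℝ j).eq_of_nhds, iteratedFDeriv_add_apply
    (((hdG.contDiffOn.clm_apply hh).contDiffAt hUp).of_le hle)
    (((hW.clm_apply hG.contDiffOn).contDiffAt hUp).of_le hle)]
  have hXp : DifferentiableAt ℝ X p := (hX.contDiffAt hUp).differentiableAt (by simp)
  -- For k = 0 the truncated k - 1 is 0, and order 2 of h alone is more than enough.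
  have h1 := iteratedFDeriv_clm_apply_eq_zero (U := U) hdG.contDiffOn hh p.2 (a := k - 1) (b := 2)
    (j := j) (fun i hi => by
      rw [← norm_eq_zero, norm_iteratedFDeriv_fderiv,
        iteratedFDeriv_homogeneousFun_of_lt _ _ (by omega), norm_zero])
    (fun i hi => by
      interval_cases i
      · rw [← norm_eq_zero, norm_iteratedFDeriv_zero]
        simp [h, hp]
      · have h2 : HasFDerivAt h (fderiv ℝ X p - fderiv ℝ X p) p :=
          hXp.hasFDerivAt.sub ((fderiv ℝ X p).hasFDerivAt.comp (p : E)
            ((hasFDerivAt_id (p : E)).sub_const (p : E)))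
        rw [← norm_eq_zero, norm_iteratedFDeriv_one, h2.fderiv, sub_self, norm_zero])
    (by omega)
  have h2 := iteratedFDeriv_clm_apply_eq_zero (U := U) hW hG.contDiffOn p.2 (a := 1) (b := k)
    (j := j) (fun i hi => by
      obtain rfl : i = 0 := by omega
      rw [← norm_eq_zero, norm_iteratedFDeriv_zero]
      simp [W])
    (fun i hi => iteratedFDeriv_homogeneousFun_of_lt _ _ hi) (by omega)
  rw [h1, h2, add_zero]

end Homogeneous

/-! ### Vanishing on functions of high order -/

section Descent

variable {𝕜 : Type*} [RCLike 𝕜] {E : Type*} [NormedAddCommGroup E] [NormedSpace ℝ E]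
  [FiniteDimensional ℝ E] {U : Opens E}
  {V : Type*} [NormedAddCommGroup V] [NormedSpace ℝ V] [NormedSpace 𝕜 V] [IsScalarTower ℝ 𝕜 V]
  [FiniteDimensional 𝕜 V] {X : E → E} {Γ : E → E →L[ℝ] V →L[𝕜] V} {A : E → V →L[𝕜] V}

omit [FiniteDimensional ℝ E] [FiniteDimensional 𝕜 V] in
theorem vanishing_antitone (p : U) : Antitone (vanishing 𝕜 V p) :=
  fun _ _ h _ hu k hk => hu k (hk.trans_le h)

/-- Non-resonance in degree `k`, with repeated eigenvalues, follows from non-resonance in terms of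
multi-indices of length `k`. -/
theorem ne_sum_add_of_forall_multiIndex {ι : Type*} [Fintype ι] {μ : ι → ℂ} {S : Multiset ℂ}
    (hS : S = Multiset.map μ Finset.univ.val) {R : Multiset ℂ} {l : ℂ} {N k : ℕ} (hk : N < k)
    (hN : ∀ α : ι → ℕ, ∀ ρ ∈ R, l = (∑ i, (α i : ℂ) * μ i) + ρ → ∑ i, α i ≤ N)
    (z : Fin k → ℂ) (hz : ∀ i, z i ∈ S) (ρ : ℂ) (hρ : ρ ∈ R) : l ≠ ∑ i, z i + ρ := by
  classical
  intro h
  have hz' : ∀ i, ∃ j, μ j = z i := fun i => by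
    have := hz i
    rw [hS, Multiset.mem_map] at this
    obtain ⟨j, -, hj⟩ := this
    exact ⟨j, hj⟩
  choose f hf using hz'
  -- Grouping equal indices gives a multi-index whose length is the number k > N of summands.
  have h1 : ∑ i, z i = ∑ j, ((Finset.univ.filter fun i => f i = j).card : ℂ) * μ j := by
    rw [← Finset.sum_fiberwise Finset.univ f]
    refine Finset.sum_congr rfl fun j _ => ?_
    rw [Finset.sum_congr rfl (g := fun _ => μ j), Finset.sum_const, nsmul_eq_mul]
    intro i hi
    rw [← hf, (Finset.mem_filter.1 hi).2]
  have h2 := hN (fun j => (Finset.univ.filter fun i => f i = j).card) ρ hρ (h.trans (by rw [h1]))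
  rw [← Finset.card_eq_sum_card_fiberwise (fun i _ => Finset.mem_coe.2 (Finset.mem_univ (f i))),
    Finset.card_univ, Fintype.card_fin] at h2
  omega

omit [FiniteDimensional ℝ E] [FiniteDimensional 𝕜 V] in
/-- An eigenfunctional that vanishes to order `k + 1` also vanishes to order `k`, unless
there is a resonance of degree `k`. -/
theorem apply_eq_zero_of_mem_vanishing_of_isUnit (hX : ContDiffOn ℝ ∞ X U)
    (hΓ : ContDiffOn ℝ ∞ Γ U) (hA : ContDiffOn ℝ ∞ A U) {p : U} (hp : X p = 0) {lam : 𝕜}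
    {T : CompactDistribution 𝕜 U V} (hT : ∀ u, T (operator hX hΓ hA u) = lam * T u) {k : ℕ}
    (hunit : IsUnit (symbolOp k (fderiv ℝ X p) (A p) -
      algebraMap 𝕜 (Module.End 𝕜 (E [×k]→L[ℝ] V)) lam))
    (hTk : ∀ u ∈ vanishing 𝕜 V p (k + 1), T u = 0) {u : SmoothFun 𝕜 U V}
    (hu : u ∈ vanishing 𝕜 V p k) : T u = 0 := by
  -- Up to functions vanishing to order k + 1, u is the polynomial of (symbol - λ)g and hence ∇_X +
  -- A - λ applied to the polynomial of g, which T kills.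
  obtain ⟨g, hg⟩ := ((Module.End.isUnit_iff _).1 hunit).2
    ((k.factorial : ℝ)⁻¹ • iteratedFDeriv ℝ k u p)
  have h1 := hTk _ (sub_homogeneous_mem_vanishing hu)
  have h2 := hTk _ (operator_homogeneous_sub_mem_vanishing hX hΓ hA hp g)
  rw [← hg, LinearMap.sub_apply, Module.algebraMap_end_apply, homogeneous_sub_smul, map_sub,
    map_sub, map_smul, smul_eq_mul] at h1
  rw [map_sub, hT] at h2
  linear_combination h1 - h2

/-- An eigenfunctional that vanishes near the source vanishes on all functions that vanish to an
order that exceeds the degrees of all resonances. -/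
theorem apply_eq_zero_of_mem_vanishing (hX : ContDiffOn ℝ ∞ X U)
    (hΓ : ContDiffOn ℝ ∞ Γ U) (hA : ContDiffOn ℝ ∞ A U) {p : U} (hp : X p = 0) {lam : 𝕜}
    {T : CompactDistribution 𝕜 U V} (hT : ∀ u, T (operator hX hΓ hA u) = lam * T u)
    (h0 : ∀ u : SmoothFun 𝕜 U V, ⇑u =ᶠ[𝓝 (p : E)] 0 → T u = 0) {ι : Type*} [Fintype ι] {μ : ι → ℂ}
    (hμ : eigenvalues (linearization X p) = Multiset.map μ Finset.univ.val) {N : ℕ}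
    (hN : ∀ α : ι → ℕ, ∀ ρ ∈ eigenvalues (A p).toLinearMap,
      toComplex 𝕜 lam = (∑ i, (α i : ℂ) * μ i) + ρ → ∑ i, α i ≤ N)
    {u : SmoothFun 𝕜 U V} (hu : u ∈ vanishing 𝕜 V p (N + 1)) : T u = 0 := by
  obtain ⟨M, hM⟩ := exists_forall_vanishing_apply_eq_zero h0
  -- Starting at N + 1 + M covers both orders, whichever of M and N + 1 is larger.
  have hM' : ∀ u ∈ vanishing 𝕜 V p (N + 1 + M), T u = 0 :=
    fun u hu => hM u (vanishing_antitone p (by omega) hu)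
  refine Nat.decreasingInduction (n := N + 1 + M) (m := N + 1)
    (motive := fun k _ => N + 1 ≤ k → ∀ u ∈ vanishing 𝕜 V p k, T u = 0) ?_ (fun _ => hM')
    (by omega) le_rfl u hu
  intro k _ ih hk u hu
  refine apply_eq_zero_of_mem_vanishing_of_isUnit hX hΓ hA hp hT ?_ (ih (by omega)) hu
  exact isUnit_symbolOp_sub k _ _ fun z hz ρ hρ =>
    ne_sum_add_of_forall_multiIndex hμ (by omega) hN z hz ρ hρ

end Descent

/-! ### Functionals on jets -/

section Jets

variable {𝕜 : Type*} [RCLike 𝕜] {E : Type*} [NormedAddCommGroup E] [NormedSpace ℝ E]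
  [FiniteDimensional ℝ E] {U : Opens E}
  {V : Type*} [NormedAddCommGroup V] [NormedSpace ℝ V] [NormedSpace 𝕜 V] [IsScalarTower ℝ 𝕜 V]
  [FiniteDimensional 𝕜 V]

theorem finiteDimensional_continuousMultilinearMap (k : ℕ) [FiniteDimensional ℝ V] :
    FiniteDimensional ℝ (E [×k]→L[ℝ] V) :=
  FiniteDimensional.of_injective (ContinuousMultilinearMap.toMultilinearMapLinear :
    (E [×k]→L[ℝ] V) →ₗ[ℝ] MultilinearMap ℝ (fun _ : Fin k => E) V)
      ContinuousMultilinearMap.toMultilinearMap_injective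

variable (𝕜 V) in
/-- The derivatives of order at most `N` at `p`. -/
noncomputable def derivatives (p : U) (N : ℕ) :
    SmoothFun 𝕜 U V →ₗ[𝕜] ∀ k : Fin (N + 1), E [×k]→L[ℝ] V where
  toFun u k := iteratedFDeriv ℝ k u p
  map_add' u v := funext fun k => u.iteratedFDeriv_add v k p.2
  map_smul' c u := funext fun k => u.iteratedFDeriv_smul c k p.2

/-- The functional kills all u whose derivatives up to order N vanish at p, so it factors through
the finite-dimensional space of these derivatives, where every linear functional is bounded. -/
theorem exists_jet_bound (p : U) (N : ℕ) (F : JetSpace 𝕜 V p N →ₗ[𝕜] 𝕜) :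
    ∃ C : ℝ, 0 ≤ C ∧ ∀ u : SmoothFun 𝕜 U V,
      ‖F (jet p N u)‖ ≤ C * ∑ k ∈ Finset.range (N + 1), ‖iteratedFDeriv ℝ k u p‖ := by
  have hV : FiniteDimensional ℝ V := FiniteDimensional.trans ℝ 𝕜 V
  have hfin : ∀ k : ℕ, FiniteDimensional ℝ (E [×k]→L[ℝ] V) :=
    fun k => finiteDimensional_continuousMultilinearMap k
  obtain ⟨G, hG⟩ : F ∘ₗ (vanishing 𝕜 V p (N + 1)).mkQ ∈
      LinearMap.range (derivatives 𝕜 V p N).dualMap := by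
    rw [LinearMap.range_dualMap_eq_dualAnnihilator_ker, Submodule.mem_dualAnnihilator]
    intro u hu
    have : u ∈ vanishing 𝕜 V p (N + 1) := fun k hk => congrFun hu ⟨k, hk⟩
    rw [LinearMap.comp_apply, Submodule.mkQ_apply, (Submodule.Quotient.mk_eq_zero _).2 this,
      map_zero]
  let H : (∀ k : Fin (N + 1), E [×k]→L[ℝ] V) →L[ℝ] 𝕜 :=
    LinearMap.toContinuousLinearMap (G.restrictScalars ℝ)
  refine ⟨‖H‖, H.opNorm_nonneg, fun u => ?_⟩
  have h1 : F (jet p N u) = H (derivatives 𝕜 V p N u) := (LinearMap.congr_fun hG u).symm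
  rw [h1]
  refine (H.le_opNorm _).trans (mul_le_mul_of_nonneg_left ?_ H.opNorm_nonneg)
  refine (pi_norm_le_iff_of_nonneg (Finset.sum_nonneg fun _ _ => norm_nonneg _)).2 fun k => ?_
  exact Finset.single_le_sum (f := fun k => ‖iteratedFDeriv ℝ k u p‖)
    (fun _ _ => norm_nonneg _) (Finset.mem_range.2 k.2)

theorem exists_compactIn_mem {E : Type*} [NormedAddCommGroup E] {U : Opens E} (p : U) : ∃ K : CompactIn U, (p : E) ∈ K.1 :=
  ⟨⟨⟨{(p : E)}, isCompact_singleton⟩, Set.singleton_subset_iff.2 p.2⟩, rfl⟩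

/-- The functional on `C^∞(U, V)` defined by a functional on jets. -/
noncomputable def jetFunctional (p : U) (N : ℕ) (F : JetSpace 𝕜 V p N →ₗ[𝕜] 𝕜) :
    CompactDistribution 𝕜 U V where
  toLinearMap := F ∘ₗ (vanishing 𝕜 V p (N + 1)).mkQ
  cont := by
    obtain ⟨C, hC0, hC⟩ := exists_jet_bound p N F
    obtain ⟨K, hK⟩ := exists_compactIn_mem p
    let s : Finset (CompactIn U × ℕ) := (Finset.range (N + 1)).map
      ⟨fun j => (K, j), fun _ _ h => (Prod.ext_iff.1 h).2⟩
    refine WithSeminorms.continuous_normedSpace_rng _ withSeminorms _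
      ⟨s, ⟨C * (N + 1), by positivity⟩, fun u => (hC u).trans ?_⟩
    have hle : ∀ k ∈ Finset.range (N + 1),
        ‖iteratedFDeriv ℝ k u p‖ ≤ (s.sup (seminormFamily 𝕜 U V)) u := fun k hk =>
      (le_derivSeminorm K k u hK).trans (Seminorm.le_finset_sup_apply
        (p := seminormFamily 𝕜 U V) (i := (K, k)) (Finset.mem_map.2 ⟨k, hk, rfl⟩))
    change _ ≤ C * (N + 1) * _
    rw [mul_assoc]
    refine mul_le_mul_of_nonneg_left ((Finset.sum_le_card_nsmul _ _ _ hle).trans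
      (le_of_eq ?_)) hC0
    rw [Finset.card_range, nsmul_eq_mul, Nat.cast_succ]

omit [FiniteDimensional ℝ E] [FiniteDimensional 𝕜 V] in
theorem dsupport_subset_singleton {p : U} {T : CompactDistribution 𝕜 U V}
    (h0 : ∀ u : SmoothFun 𝕜 U V, ⇑u =ᶠ[𝓝 (p : E)] 0 → T u = 0) : Distribution.dsupport T ⊆ {(p : E)} := by
  intro x hx
  by_contra hxp
  refine (Distribution.notMem_dsupport_iff x).2 ⟨{(p : E)}ᶜ, fun u hu => ?_,
    isOpen_compl_singleton, hxp⟩ hx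
  exact h0 u (notMem_tsupport_iff_eventuallyEq.1 fun h => hu h rfl)

/-- T factors through N-jets at p, so the derivatives at p alone bound it. If p is not in K,
functions supported in K vanish near p and there is nothing to bound. -/
theorem hasOrderLE_of_vanishing {p : U} {N : ℕ} {T : CompactDistribution 𝕜 U V}
    (h0 : ∀ u : SmoothFun 𝕜 U V, ⇑u =ᶠ[𝓝 (p : E)] 0 → T u = 0)
    (hT : ∀ u ∈ vanishing 𝕜 V p (N + 1), T u = 0) : HasOrderLE T N := by
  intro K
  obtain ⟨C, hC0, hC⟩ := exists_jet_bound p N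
    ((vanishing 𝕜 V p (N + 1)).liftQ T.toLinearMap fun u hu => hT u hu)
  refine ⟨C, fun u hu => ?_⟩
  by_cases hp : (p : E) ∈ K.1
  · refine (hC u).trans (mul_le_mul_of_nonneg_left (Finset.sum_le_sum fun k _ =>
      le_derivSeminorm K k u hp) hC0)
  · rw [h0 u (notMem_tsupport_iff_eventuallyEq.1 fun h => hp (hu h)), norm_zero]
    exact mul_nonneg hC0 (Finset.sum_nonneg fun _ _ => apply_nonneg _ _)

end Jets

/-! ### Eigendistributions as eigenfunctionals on jets -/

section Correspondence

variable {𝕜 : Type*} [RCLike 𝕜] {E : Type*} [NormedAddCommGroup E] [NormedSpace ℝ E]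
  [FiniteDimensional ℝ E] {U : Opens E}
  {V : Type*} [NormedAddCommGroup V] [NormedSpace ℝ V] [NormedSpace 𝕜 V] [IsScalarTower ℝ 𝕜 V]
  [FiniteDimensional 𝕜 V] {X : E → E} {Γ : E → E →L[ℝ] V →L[𝕜] V} {A : E → V →L[𝕜] V}

/-- If all eigenfunctionals of `∇_X + A` vanish to order `N + 1`, they are the eigenfunctionals of
the operator induced on jets. -/
noncomputable def eigenspaceEquiv (hX : ContDiffOn ℝ ∞ X U) (hΓ : ContDiffOn ℝ ∞ Γ U)
    (hA : ContDiffOn ℝ ∞ A U) {p : U} (hp : X p = 0) (lam : 𝕜) (N : ℕ)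
    (hT : ∀ T : CompactDistribution 𝕜 U V, dualOperator (operator hX hΓ hA) T = lam • T →
      ∀ u ∈ vanishing 𝕜 V p (N + 1), T u = 0) :
    Module.End.eigenspace (dualOperator (operator hX hΓ hA)) lam ≃ₗ[𝕜]
      Module.End.eigenspace (jetOperator hX hΓ hA hp N).dualMap lam where
  toFun T := ⟨(vanishing 𝕜 V p (N + 1)).liftQ T.1.toLinearMap
      fun u hu => hT T.1 (Module.End.mem_eigenspace_iff.1 T.2) u hu,
    Module.End.mem_eigenspace_iff.2 (Submodule.linearMap_qext _ (LinearMap.ext fun u =>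
      DFunLike.congr_fun (Module.End.mem_eigenspace_iff.1 T.2) u))⟩
  map_add' _ _ := Subtype.ext (Submodule.linearMap_qext _ rfl)
  map_smul' _ _ := Subtype.ext (Submodule.linearMap_qext _ rfl)
  invFun F := ⟨jetFunctional p N F.1, Module.End.mem_eigenspace_iff.2
    (ContinuousLinearMap.ext fun u =>
      LinearMap.congr_fun (Module.End.mem_eigenspace_iff.1 F.2) (jet p N u))⟩
  left_inv _ := rfl
  right_inv _ := Subtype.ext (Submodule.linearMap_qext _ rfl)

end Correspondence

end SourceOperator

theorem mainTheorem6 {𝕜 : Type*} [RCLike 𝕜] {n : ℕ}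
    {V : Type*} [NormedAddCommGroup V] [NormedSpace ℝ V] [NormedSpace 𝕜 V] [IsScalarTower ℝ 𝕜 V]
    [FiniteDimensional 𝕜 V]
    (U : TopologicalSpace.Opens (EuclideanSpace ℝ (Fin n))) (p : U)
    {X : EuclideanSpace ℝ (Fin n) → EuclideanSpace ℝ (Fin n)}
    {Γ : EuclideanSpace ℝ (Fin n) → EuclideanSpace ℝ (Fin n) →L[ℝ] V →L[𝕜] V}
    {A : EuclideanSpace ℝ (Fin n) → V →L[𝕜] V}
    (hX : ContDiffOn ℝ ∞ X U) (hΓ : ContDiffOn ℝ ∞ Γ U) (hA : ContDiffOn ℝ ∞ A U)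
    (hp : SourceOperator.IsStrictlyPositiveSource X p)
    (hU : SourceOperator.IsStarShaped (U : Set (EuclideanSpace ℝ (Fin n))) X p)
    (μ : Fin n → ℂ)
    (hμ : SourceOperator.eigenvalues (SourceOperator.linearization X p) =
      Multiset.map μ Finset.univ.val)
    (lam : 𝕜) (N : ℕ)
    (hN : ∀ (α : Fin n → ℕ), ∀ ρ ∈ SourceOperator.eigenvalues (A p).toLinearMap,
      SourceOperator.toComplex 𝕜 lam = (∑ i, (α i : ℂ) * μ i) + ρ → ∑ i, α i ≤ N) :
    (∃ e : Module.End.eigenspace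
          (SourceOperator.dualOperator (SourceOperator.operator hX hΓ hA)) lam ≃ₗ[𝕜]
        Module.End.eigenspace
          (SourceOperator.jetOperator hX hΓ hA hp.apply_eq_zero N).dualMap lam,
      ∀ (T : Module.End.eigenspace
          (SourceOperator.dualOperator (SourceOperator.operator hX hΓ hA)) lam)
        (u : SourceOperator.SmoothFun 𝕜 U V),
        (e T).1 (SourceOperator.jet p N u) = T.1 u) ∧
    ∀ T : SourceOperator.CompactDistribution 𝕜 U V,
      SourceOperator.dualOperator (SourceOperator.operator hX hΓ hA) T = lam • T →
        Distribution.dsupport T ⊆ {(p : EuclideanSpace ℝ (Fin n))} ∧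
          SourceOperator.HasOrderLE T N := by
  have h0 : ∀ T : SourceOperator.CompactDistribution 𝕜 U V,
      SourceOperator.dualOperator (SourceOperator.operator hX hΓ hA) T = lam • T →
        ∀ u : SourceOperator.SmoothFun 𝕜 U V,
          ⇑u =ᶠ[𝓝 (p : EuclideanSpace ℝ (Fin n))] 0 → T u = 0 := fun T hT u hu =>
    SourceOperator.apply_eq_zero_of_eventuallyEq_zero hX hΓ hA hp hU
      (fun u => DFunLike.congr_fun hT u) hu
  have h1 : ∀ T : SourceOperator.CompactDistribution 𝕜 U V,
      SourceOperator.dualOperator (SourceOperator.operator hX hΓ hA) T = lam • T →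
        ∀ u ∈ SourceOperator.vanishing 𝕜 V p (N + 1), T u = 0 := fun T hT u hu =>
    SourceOperator.apply_eq_zero_of_mem_vanishing hX hΓ hA hp.apply_eq_zero
      (fun u => DFunLike.congr_fun hT u) (h0 T hT) hμ hN hu
  exact ⟨⟨SourceOperator.eigenspaceEquiv hX hΓ hA hp.apply_eq_zero lam N h1, fun _ _ => rfl⟩,
    fun T hT => ⟨SourceOperator.dsupport_subset_singleton (h0 T hT),
      SourceOperator.hasOrderLE_of_vanishing (h0 T hT) (h1 T hT)⟩⟩
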